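/- Let $(\mathcal E,\times,*)$ be a cartesian closed category with all small colimits, with internal hom $[-,-]$; we also regard $\mathcal E$ as a category enriched over itself. Let $\mathcal P$ be a small coloured symmetric operad enriched in $(\mathcal E,\times,*)$ with set of colours $\mathrm{Ob}(\mathcal P)$: it has objects of operations $\mathcal P(\underline c;c)$ for every tuple of colours $\underline c=(\underline c[1],\dots,\underline c[n])$, $n\ge 0$, and every colour $c$, actions $\sigma^*:\mathcal P(\underline c;c)\to\mathcal P(\underline c^\sigma;c)$ of permutations, where $\underline c^{\sigma}=(\underline c[\sigma(1)],\dots,\underline c[\sigma(n)])$, units $\eta:*\to\mathcal P(c;c)$ and partial compositions $\gamma_i:\mathcal P(\underline c;c)\times\mathcal P(\underline c';\underline c[i])\to\mathcal P(\underline c\triangleleft_i\underline c';c)$, where $\underline c\triangleleft_i\underline c'$ is obtained from $\underline c$ by replacing its $i$-th entry by $\underline c'$. A $\mathcal P$-coalgebra is a family of objects $(V(c))_{c\in\mathrm{Ob}(\mathcal P)}$ of $\mathcal E$ with structure maps $V(c)\times\mathcal P(\underline c;c)\to V(\underline c[1])\times\cdots\times V(\underline c[n])$ compatible with the units, the partial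 compositions and the permutations. For two colours $c,c'$ let $X(c,c')$ be the quotient in $\mathcal E$ of the coproduct of the objects $\mathcal P(\underline c;c)$ over all pairs $(\underline c,i)$ with $1\le i\le|\underline c|$ and $\underline c[i]=c'$ by the following relations: (a) for every permutation $\sigma$, the inclusion of the summand $\mathcal P(\underline c;c)$ indexed by $(\underline c,i)$ is identified with $\sigma^*$ followed by the inclusion of the summand indexed by $(\underline c^\sigma,\sigma^{-1}(i))$; (b) for every $k\ne i$ and every (possibly empty) tuple $\underline c'$, the map on $\mathcal P(\underline c;c)\times\mathcal P(\underline c';\underline c[k])$ given by the first projection followed by the inclusion of the summand indexed by $(\underline c,i)$ is identified with $\gamma_k$ followed by the inclusion of the summand indexed by $(\underline c\triangleleft_k\underline c',i')$, where $i'$ is the position of the $i$-th entry of $\underline c$ in $\underline c\triangleleft_k\underline c'$. Then there exists an $\mathcal E$-enriched category $\mathcal P_{\mathrm{cart}}$ with set of objects $\mathrm{Ob}(\mathcal P)$ which is the quotient, in enriched categories, of the enriched category freely generated by the enriched graph $X$ by the following relations: (c) for all $\underline c,c,i,\underline c',j$, the map $\mathcal P(\underline c;c)\times\mathcal P(\underline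 c';\underline c[i])\to X(c,\underline c[i])\times X(\underline c[i],\underline c'[j])$ given by the positions $i$ and $j$, followed by composition, equals $\gamma_i$ followed by the map $\mathcal P(\underline c\triangleleft_i\underline c';c)\to X(c,\underline c'[j])$ given by the position $i+j-1$; (d) for every $c$, the map $*\xrightarrow{\eta}\mathcal P(c;c)\to X(c,c)$ is the identity of $c$. Moreover there are canonical isomorphisms of categories $$\mathrm{Cog}_{\mathcal E}(\mathcal P)\;\cong\;\mathrm{Cog}_{\mathcal E}(\mathcal P_{\mathrm{cart}}^{\mathrm{op}})\;\cong\;\mathrm{Alg}_{\mathcal E}(\mathcal P_{\mathrm{cart}})$$ commuting with the forgetful functors to $\mathcal E^{\mathrm{Ob}(\mathcal P)}$. Here $\mathcal P_{\mathrm{cart}}^{\mathrm{op}}$ is seen as an enriched operad with only unary operations (the other objects of operations are initial), and $\mathrm{Alg}_{\mathcal E}(\mathcal P_{\mathrm{cart}})$ is the category of enriched functors $\mathcal P_{\mathrm{cart}}\to\mathcal E$ and enriched natural transformations. Canonical means the following. The second isomorphism sends a coalgebra to the enriched functor whose maps $\mathcal P_{\mathrm{cart}}(c,c')\to[V(c),V(c')]$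 are adjoint to the structure maps in arity one. The composite isomorphism sends a $\mathcal P$-coalgebra $V$ to the enriched functor with the same underlying objects for which the composite $\mathcal P(\underline c;c)\to X(c,\underline c[i])\to\mathcal P_{\mathrm{cart}}(c,\underline c[i])\to[V(c),V(\underline c[i])]$ is adjoint to $V(c)\times\mathcal P(\underline c;c)\to V(\underline c[1])\times\cdots\times V(\underline c[n])\to V(\underline c[i])$, for every $\underline c$, $c$ and $i$. -/

import Mathlib

open CategoryTheory MonoidalCategory Limits Opposite

universe w w' v u

noncomputable section

namespace ColouredOperad

/-! ### Tuples of colours -/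

/-- A finite tuple of colours: an object of the groupoid of tuples of elements of `C`. -/
structure ColTuple (C : Type w) where
  /-- the length of the tuple -/
  len : ℕ
  /-- the colours of the tuple -/
  col : Fin len → C

namespace ColTuple

variable {C : Type w}

lemma ext_col {c d : ColTuple C} (h : c.len = d.len)
    (h' : ∀ (p : ℕ) (hp : p < c.len), c.col ⟨p, hp⟩ = d.col ⟨p, h ▸ hp⟩) : c = d := by
  obtain ⟨n, c⟩ := c
  obtain ⟨m, d⟩ := d
  obtain rfl : n = m := h
  congr 1
  funext p
  exact h' p.1 p.2

/-- Morphisms of tuples are bijections of the positions which respect the colours. (They only exist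
between tuples of the same length.) -/
@[ext]
structure Hom (c d : ColTuple C) where
  /-- the underlying bijection -/
  equiv : Fin c.len ≃ Fin d.len
  /-- it respects the colours -/
  col_equiv : ∀ p, d.col (equiv p) = c.col p

instance : Category.{0} (ColTuple C) where
  Hom c d := Hom c d
  id c := ⟨Equiv.refl _, fun _ => rfl⟩
  comp f g := ⟨f.equiv.trans g.equiv, fun p => (g.col_equiv _).trans (f.col_equiv p)⟩

/-- The tuple with a single colour. -/
abbrev single (x : C) : ColTuple C := ⟨1, fun _ => x⟩

/-- The positions of a tuple of length `n` whose `i`-th entry has been replaced by a tuple of length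
`m` are, in order: the positions `< i` of the first tuple, all the positions of the second tuple,
and the positions `> i` of the first tuple. -/
def insertEquiv {n m : ℕ} (i : Fin n) : Fin (n - 1 + m) ≃ {k : Fin n // k ≠ i} ⊕ Fin m where
  toFun p :=
    if h₁ : p.1 < i.1 then .inl ⟨⟨p.1, by omega⟩, fun h => by simp [← h] at h₁⟩
    else if h₂ : p.1 < i.1 + m then .inr ⟨p.1 - i.1, by omega⟩
    else .inl ⟨⟨p.1 - m + 1, by omega⟩, fun h => by simp [← h] at h₁ h₂; omega⟩
  invFun := Sum.elim
    (fun k => if h : k.1.1 < i.1 then ⟨k.1.1, by omega⟩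
      else ⟨k.1.1 - 1 + m, by have := k.1.2; have := fun e => k.2 (Fin.ext e); omega⟩)
    (fun j => ⟨i.1 + j.1, by omega⟩)
  left_inv p := by
    dsimp only
    split_ifs with h₁ h₂
    · simp only [Sum.elim_inl]
      rw [dif_pos h₁]
    · simp only [Sum.elim_inr, Fin.ext_iff]; omega
    · simp only [Sum.elim_inl]
      rw [dif_neg (by omega)]
      simp only [Fin.ext_iff]; omega
  right_inv s := by
    rcases s with ⟨k, hk⟩ | j
    · have hk' : k.1 ≠ i.1 := fun h => hk (Fin.ext h)
      by_cases h : k.1 < i.1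
      · simp only [Sum.elim_inl, dif_pos h]
      · simp only [Sum.elim_inl, dif_neg h]
        rw [dif_neg (by omega), dif_neg (by omega)]
        simp only [Sum.inl.injEq, Subtype.mk.injEq, Fin.ext_iff]; omega
    · simp

/-- `c.insert i c'` is the tuple `c ◁ᵢ c'` obtained from `c` by replacing its `i`-th entry
by the tuple `c'`. -/
def insert (c : ColTuple C) (i : Fin c.len) (c' : ColTuple C) : ColTuple C where
  len := c.len - 1 + c'.len
  col p := Sum.elim (fun k : {k : Fin c.len // k ≠ i} => c.col k.1) c'.col (insertEquiv i p)

/-- The position in `c ◁ᵢ c'` of the position `k ≠ i` of `c`. -/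
def posOuter (c : ColTuple C) (i : Fin c.len) (c' : ColTuple C) (k : Fin c.len) (hk : k ≠ i) :
    Fin (c.insert i c').len :=
  (insertEquiv i).symm (.inl ⟨k, hk⟩)

/-- The position in `c ◁ᵢ c'` of the position `j` of `c'`. -/
def posInner (c : ColTuple C) (i : Fin c.len) (c' : ColTuple C) (j : Fin c'.len) :
    Fin (c.insert i c').len :=
  (insertEquiv i).symm (.inr j)

@[simp]
lemma col_posOuter (c : ColTuple C) (i : Fin c.len) (c' : ColTuple C) (k : Fin c.len)
    (hk : k ≠ i) : (c.insert i c').col (c.posOuter i c' k hk) = c.col k := by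
  simp [insert, posOuter]

@[simp]
lemma col_posInner (c : ColTuple C) (i : Fin c.len) (c' : ColTuple C) (j : Fin c'.len) :
    (c.insert i c').col (c.posInner i c' j) = c'.col j := by
  simp [insert, posInner]

lemma posOuter_val (c : ColTuple C) (i : Fin c.len) (c' : ColTuple C) (k : Fin c.len)
    (hk : k ≠ i) :
    (c.posOuter i c' k hk).1 = if k.1 < i.1 then k.1 else k.1 - 1 + c'.len := by
  simp only [posOuter, insertEquiv, Equiv.coe_fn_symm_mk, Sum.elim_inl]
  split_ifs <;> rfl

lemma posInner_val (c : ColTuple C) (i : Fin c.len) (c' : ColTuple C) (j : Fin c'.len) :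
    (c.posInner i c' j).1 = i.1 + j.1 := rfl

lemma insert_col_lt (c : ColTuple C) (i : Fin c.len) (c' : ColTuple C) (p : ℕ) (hp)
    (h : p < i.1) : (c.insert i c').col ⟨p, hp⟩ = c.col ⟨p, by omega⟩ := by
  simp [insert, insertEquiv, h]

lemma insert_col_mid (c : ColTuple C) (i : Fin c.len) (c' : ColTuple C) (p : ℕ) (hp)
    (h : i.1 ≤ p) (h' : p < i.1 + c'.len) :
    (c.insert i c').col ⟨p, hp⟩ = c'.col ⟨p - i.1, by omega⟩ := by
  simp [insert, insertEquiv, h', Nat.not_lt.2 h]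

lemma insert_col_gt (c : ColTuple C) (i : Fin c.len) (c' : ColTuple C) (p : ℕ) (hp)
    (h : i.1 + c'.len ≤ p) :
    (c.insert i c').col ⟨p, hp⟩ =
      c.col ⟨p - c'.len + 1, by have : p < c.len - 1 + c'.len := hp; omega⟩ := by
  have h₁ : ¬ p < i.1 := by omega
  simp [insert, insertEquiv, h₁, Nat.not_lt.2 h]

lemma insert_single (c : ColTuple C) (i : Fin c.len) {d : C} (h : c.col i = d) :
    c.insert i (single d) = c := by
  have hi := i.2
  have hl : (c.insert i (single d)).len = c.len := by
    change c.len - 1 + 1 = c.len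
    omega
  refine ext_col hl fun p hp => ?_
  rcases lt_trichotomy p i.1 with h₁ | h₁ | h₁
  · rw [insert_col_lt _ _ _ _ _ h₁]
  · rw [insert_col_mid _ _ _ _ _ h₁.ge (by rw [h₁]; exact Nat.lt_succ_self _)]
    subst h₁
    exact h.symm
  · rw [insert_col_gt _ _ _ _ _ h₁]
    congr 1
    ext
    change p - 1 + 1 = p
    omega

lemma single_insert (x : C) (c : ColTuple C) : (single x).insert (0 : Fin 1) c = c := by
  refine ext_col (Nat.zero_add _) fun p hp => ?_
  exact insert_col_mid (single x) (0 : Fin 1) c p hp (Nat.zero_le _)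
    (by have : p < 0 + c.len := hp; simpa using this)

lemma insert_insert_inner (c : ColTuple C) (i : Fin c.len) (c' : ColTuple C) (j : Fin c'.len)
    (c'' : ColTuple C) :
    (c.insert i c').insert (c.posInner i c' j) c'' = c.insert i (c'.insert j c'') := by
  have hi := i.2
  have hj := j.2
  have hl₁ : (c.insert i c').len = c.len - 1 + c'.len := rfl
  have hl₂ : (c'.insert j c'').len = c'.len - 1 + c''.len := rfl
  have hv := c.posInner_val i c' j
  refine ext_col (by
    change c.len - 1 + c'.len - 1 + c''.len = c.len - 1 + (c'.len - 1 + c''.len)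
    omega) fun p hp => ?_
  have hp' : p < c.len - 1 + c'.len - 1 + c''.len := hp
  rcases Nat.lt_or_ge p i.1 with h₁ | h₁
  · rw [insert_col_lt _ _ _ _ _ (by omega), insert_col_lt _ _ _ _ _ h₁,
      insert_col_lt _ _ _ _ _ h₁]
  rcases Nat.lt_or_ge p (i.1 + j.1) with h₂ | h₂
  · rw [insert_col_lt _ _ _ _ _ (by omega), insert_col_mid _ _ _ _ _ h₁ (by omega),
      insert_col_mid _ _ _ _ _ h₁ (by omega), insert_col_lt _ _ _ _ _ (by omega)]
  rcases Nat.lt_or_ge p (i.1 + j.1 + c''.len) with h₃ | h₃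
  · rw [insert_col_mid _ _ _ _ _ (by omega) (by omega),
      insert_col_mid _ _ _ _ _ h₁ (by omega), insert_col_mid _ _ _ _ _ (by omega) (by omega)]
    congr 1
    ext
    change p - (c.posInner i c' j).1 = p - i.1 - j.1
    omega
  rcases Nat.lt_or_ge p (i.1 + (c'.len - 1 + c''.len)) with h₄ | h₄
  · rw [insert_col_gt _ _ _ _ _ (by omega), insert_col_mid _ _ _ _ _ (by omega) (by omega),
      insert_col_mid _ _ _ _ _ h₁ (by omega), insert_col_gt _ _ _ _ _ (by omega)]
    congr 1
    ext
    change p - c''.len + 1 - i.1 = p - i.1 - c''.len + 1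
    omega
  · rw [insert_col_gt _ _ _ _ _ (by omega), insert_col_gt _ _ _ _ _ (by omega),
      insert_col_gt _ _ _ _ _ (by omega)]
    congr 1
    ext
    change p - c''.len + 1 - c'.len + 1 = p - (c'.len - 1 + c''.len) + 1
    omega

lemma insert_insert_outer_of_lt (c : ColTuple C) (i k : Fin c.len) (h : k.1 < i.1)
    (hik : i ≠ k) (c' c'' : ColTuple C) :
    (c.insert i c').insert (c.posOuter i c' k hik.symm) c'' =
      (c.insert k c'').insert (c.posOuter k c'' i hik) c' := by
  have hi := i.2
  have hl₁ : (c.insert i c').len = c.len - 1 + c'.len := rfl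
  have hl₂ : (c.insert k c'').len = c.len - 1 + c''.len := rfl
  have hv₁ := c.posOuter_val i c' k hik.symm
  have hv₂ := c.posOuter_val k c'' i hik
  rw [if_pos h] at hv₁
  rw [if_neg (by omega)] at hv₂
  refine ext_col (by
    change c.len - 1 + c'.len - 1 + c''.len = c.len - 1 + c''.len - 1 + c'.len
    omega) fun p hp => ?_
  have hp' : p < c.len - 1 + c'.len - 1 + c''.len := hp
  rcases Nat.lt_or_ge p k.1 with h₁ | h₁
  · rw [insert_col_lt _ _ _ _ _ (by omega), insert_col_lt _ _ _ _ _ (by omega),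
      insert_col_lt _ _ _ _ _ (by omega), insert_col_lt _ _ _ _ _ (by omega)]
  rcases Nat.lt_or_ge p (k.1 + c''.len) with h₂ | h₂
  · rw [insert_col_mid _ _ _ _ _ (by omega) (by omega), insert_col_lt _ _ _ _ _ (by omega),
      insert_col_mid _ _ _ _ _ (by omega) (by omega)]
    congr 1
    ext
    change p - (c.posOuter i c' k hik.symm).1 = p - k.1
    omega
  rcases Nat.lt_or_ge p (i.1 - 1 + c''.len) with h₃ | h₃
  · rw [insert_col_gt _ _ _ _ _ (by omega), insert_col_lt _ _ _ _ _ (by omega),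
      insert_col_lt _ _ _ _ _ (by omega), insert_col_gt _ _ _ _ _ (by omega)]
  rcases Nat.lt_or_ge p (i.1 - 1 + c''.len + c'.len) with h₄ | h₄
  · rw [insert_col_gt _ _ _ _ _ (by omega), insert_col_mid _ _ _ _ _ (by omega) (by omega),
      insert_col_mid _ _ _ _ _ (by omega) (by omega)]
    congr 1
    ext
    change p - c''.len + 1 - i.1 = p - (c.posOuter k c'' i hik).1
    omega
  · rw [insert_col_gt _ _ _ _ _ (by omega), insert_col_gt _ _ _ _ _ (by omega),
      insert_col_gt _ _ _ _ _ (by omega), insert_col_gt _ _ _ _ _ (by omega)]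
    congr 1
    ext
    change p - c''.len + 1 - c'.len + 1 = p - c'.len + 1 - c''.len + 1
    omega

lemma insert_insert_outer (c : ColTuple C) (i k : Fin c.len) (hik : i ≠ k)
    (c' c'' : ColTuple C) :
    (c.insert i c').insert (c.posOuter i c' k hik.symm) c'' =
      (c.insert k c'').insert (c.posOuter k c'' i hik) c' := by
  rcases Nat.lt_or_ge k.1 i.1 with h | h
  · exact insert_insert_outer_of_lt c i k h hik c' c''
  · have h' : i.1 < k.1 := lt_of_le_of_ne h fun e => hik (Fin.ext e)
    exact (insert_insert_outer_of_lt c k i h' hik.symm c'' c').symm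

/-- The morphism `d ◁ᵢ d' ⟶ c ◁_{f(i)} c'` induced by `f : d ⟶ c` and `g : d' ⟶ c'`. -/
def insertHom {d c d' c' : ColTuple C} (f : d ⟶ c) (i : Fin d.len) (g : d' ⟶ c') :
    d.insert i d' ⟶ c.insert (f.equiv i) c' where
  equiv := (insertEquiv i).trans <|
    (Equiv.sumCongr (f.equiv.subtypeEquiv fun k => by simp) g.equiv).trans
      (insertEquiv (f.equiv i)).symm
  col_equiv p := by
    change Sum.elim _ _ (insertEquiv (f.equiv i) ((insertEquiv (f.equiv i)).symm _)) =
      Sum.elim _ _ (insertEquiv i p)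
    rw [Equiv.apply_symm_apply]
    rcases insertEquiv i p with k | j
    · exact f.col_equiv k.1
    · exact g.col_equiv j

end ColTuple

open ColTuple

/-! ### Enriched operads -/

/-- An operad enriched in `E` with set of colours `C`, presented by partial compositions.
`(seq x).obj (op c)` is the object `P(c; x)`, and a bijection `f : d ⟶ c` of tuples acts by
`(seq x).map f.op : P(c; x) ⟶ P(d; x)`. -/
structure EnrichedOperad (E : Type u) [Category.{v} E] [MonoidalCategory E] [BraidedCategory E]
    (C : Type w) where
  /-- the underlying coloured symmetric sequence -/
  seq : C → (ColTuple C)ᵒᵖ ⥤ E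
  /-- the partial composition `P(c; x) ⊗ P(c'; d) ⟶ P(c ◁ᵢ c'; x)`, where `d` is the `i`-th colour
  of `c` -/
  γ (c : ColTuple C) (i : Fin c.len) (c' : ColTuple C) {d : C} (h : c.col i = d) (x : C) :
    (seq x).obj (op c) ⊗ (seq d).obj (op c') ⟶ (seq x).obj (op (c.insert i c'))
  /-- the units -/
  η (x : C) : 𝟙_ E ⟶ (seq x).obj (op (single x))
  γ_η (c : ColTuple C) (i : Fin c.len) {d : C} (h : c.col i = d) (x : C) :
    (ρ_ _).inv ≫ _ ◁ η d ≫ γ c i (single d) h x =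
      (seq x).map (eqToHom (insert_single c i h)).op
  η_γ (c : ColTuple C) (x : C) :
    (λ_ _).inv ≫ η x ▷ _ ≫ γ (single x) (0 : Fin 1) c rfl x =
      (seq x).map (eqToHom (single_insert x c)).op
  /-- sequential associativity -/
  γ_γ_inner (c : ColTuple C) (i : Fin c.len) (c' : ColTuple C) (j : Fin c'.len)
    (c'' : ColTuple C) {d d' : C} (h : c.col i = d) (h' : c'.col j = d') (x : C) :
    γ c i c' h x ▷ _ ≫
        γ (c.insert i c') (c.posInner i c' j) c'' ((col_posInner c i c' j).trans h') x =
      (α_ _ _ _).hom ≫ _ ◁ γ c' j c'' h' d ≫ γ c i (c'.insert j c'') h x ≫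
        (seq x).map (eqToHom (insert_insert_inner c i c' j c'')).op
  /-- parallel associativity -/
  γ_γ_outer (c : ColTuple C) (i k : Fin c.len) (hik : i ≠ k) (c' c'' : ColTuple C) {d d' : C}
    (h : c.col i = d) (h' : c.col k = d') (x : C) :
    γ c i c' h x ▷ _ ≫
        γ (c.insert i c') (c.posOuter i c' k hik.symm) c''
          ((col_posOuter c i c' k hik.symm).trans h') x =
      (α_ _ _ _).hom ≫ _ ◁ (β_ _ _).hom ≫ (α_ _ _ _).inv ≫ γ c k c'' h' x ▷ _ ≫
        γ (c.insert k c'') (c.posOuter k c'' i hik) c' ((col_posOuter c k c'' i hik).trans h) x ≫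
        (seq x).map (eqToHom (insert_insert_outer c i k hik c' c'')).op
  /-- equivariance -/
  γ_equivariant {a c a' c' : ColTuple C} (f : a ⟶ c) (i : Fin a.len) (g : a' ⟶ c') {d : C}
    (h : a.col i = d) (x : C) :
    γ c (f.equiv i) c' ((f.col_equiv i).trans h) x ≫ (seq x).map (insertHom f i g).op =
      ((seq x).map f.op ⊗ₘ (seq d).map g.op) ≫ γ a i a' h x

/-! ### Coalgebras over an operad in a cartesian closed category -/

section Coalgebras

variable {E : Type u} [Category.{v} E] [CartesianMonoidalCategory E] [BraidedCategory E]
  {C : Type w}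

open CartesianMonoidalCategory

/-- The tensor product `V(c₁) × ⋯ × V(cₙ)` for `c = (c₁, …, cₙ)`. -/
abbrev prodObj (V : C → E) (c : ColTuple C) : E := ∏ᶜ fun p : Fin c.len => V (c.col p)

/-- The components of `prodInsert`. -/
def prodInsertAux (V : C → E) (c : ColTuple C) (i : Fin c.len) (c' : ColTuple C) {d : C}
    (h : c.col i = d) {W : E} (t : V d ⊗ W ⟶ prodObj V c') :
    ∀ s : {k : Fin c.len // k ≠ i} ⊕ Fin c'.len,
      prodObj V c ⊗ W ⟶ V (Sum.elim (fun k : {k : Fin c.len // k ≠ i} => c.col k.1) c'.col s)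
  | .inl k => fst _ _ ≫ Pi.π _ k.1
  | .inr j => (Pi.π _ i ≫ eqToHom (congrArg V h)) ▷ W ≫ t ≫ Pi.π (fun p => V (c'.col p)) j

/-- Given `t : V(cᵢ) × W ⟶ V(c'₁) × ⋯ × V(c'ₘ)`, the map
`(V(c₁) × ⋯ × V(cₙ)) × W ⟶ V(c₁) × ⋯ × (V(c'₁) × ⋯ × V(c'ₘ)) × ⋯ × V(cₙ)`
which applies `t` to the `i`-th factor and to `W`, and is the identity on the other factors. -/
def prodInsert (V : C → E) (c : ColTuple C) (i : Fin c.len) (c' : ColTuple C) {d : C}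
    (h : c.col i = d) {W : E} (t : V d ⊗ W ⟶ prodObj V c') :
    prodObj V c ⊗ W ⟶ prodObj V (c.insert i c') :=
  Pi.lift fun p => prodInsertAux V c i c' h t (insertEquiv i p)

/-- The map `V(c₁) × ⋯ × V(cₙ) ⟶ V(d₁) × ⋯ × V(dₙ)` which permutes the factors along a bijection
`f : d ⟶ c`. -/
def prodPermute (V : C → E) {d c : ColTuple C} (f : d ⟶ c) : prodObj V c ⟶ prodObj V d :=
  Pi.lift fun p => Pi.π (fun q => V (c.col q)) (f.equiv p) ≫ eqToHom (congrArg V (f.col_equiv p))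

/-- A coalgebra over an enriched operad: objects `V(x)` with structure maps
`V(x) × P(c₁, …, cₙ; x) ⟶ V(c₁) × ⋯ × V(cₙ)`. -/
structure OperadCoalgebra (P : EnrichedOperad E C) where
  /-- the underlying objects -/
  obj : C → E
  /-- the structure maps -/
  coact (c : ColTuple C) (x : C) : obj x ⊗ (P.seq x).obj (op c) ⟶ prodObj obj c
  coact_unit (x : C) :
    (ρ_ (obj x)).inv ≫ obj x ◁ P.η x ≫ coact (single x) x ≫
      Pi.π (fun _ : Fin 1 => obj x) 0 = 𝟙 (obj x)
  coact_permute {d c : ColTuple C} (f : d ⟶ c) (x : C) :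
    obj x ◁ (P.seq x).map f.op ≫ coact d x = coact c x ≫ prodPermute obj f
  coact_comp (c : ColTuple C) (i : Fin c.len) (c' : ColTuple C) {d : C} (h : c.col i = d)
    (x : C) :
    obj x ◁ P.γ c i c' h x ≫ coact (c.insert i c') x =
      (α_ _ _ _).inv ≫ coact c x ▷ (P.seq d).obj (op c') ≫
        prodInsert obj c i c' h (coact c' d)

namespace OperadCoalgebra

variable {P : EnrichedOperad E C}

/-- Morphisms of coalgebras. -/
@[ext]
structure Hom (V W : OperadCoalgebra P) where
  /-- the underlying morphisms -/
  app (x : C) : V.obj x ⟶ W.obj x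
  comm (c : ColTuple C) (x : C) :
    V.coact c x ≫ Limits.Pi.map (fun p => app (c.col p)) =
      app x ▷ (P.seq x).obj (op c) ≫ W.coact c x

instance : Category (OperadCoalgebra P) where
  Hom V W := Hom V W
  id V := ⟨fun x => 𝟙 _, fun c x => by simp⟩
  comp f g := ⟨fun x => f.app x ≫ g.app x, fun c x => by
    rw [comp_whiskerRight, Category.assoc, ← g.comm, reassoc_of% (f.comm c x).symm]
    congr 1
    ext p
    simp⟩

variable (P) in
/-- The forgetful functor from coalgebras to families of objects indexed by the colours. -/
def forget : OperadCoalgebra P ⥤ (C → E) where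
  obj V := V.obj
  map f := f.app

end OperadCoalgebra

end Coalgebras

/-! ### Enriched categories as enriched operads -/

section OfCategory

variable {E : Type u} [Category.{v} E] [CartesianMonoidalCategory E] [BraidedCategory E]
  [MonoidalClosed E] [HasInitial E] {B : Type w} [EnrichedCategory E B]

/-- The operations of an enriched category seen as an operad: the morphism objects in arity one,
and the initial object in the other arities. -/
def unaryObj (c : ColTuple B) (x : B) : E :=
  if h : c.len = 1 then c.col ⟨0, by omega⟩ ⟶[E] x else ⊥_ E

lemma unaryObj_eq (c : ColTuple B) (x : B) (h : c.len = 1) {y : B}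
    (hy : c.col ⟨0, by omega⟩ = y) : (unaryObj c x : E) = (y ⟶[E] x) := by
  subst hy
  exact dif_pos h

lemma unaryObj_eq_initial (c : ColTuple B) (x : B) (h : c.len ≠ 1) :
    (unaryObj c x : E) = ⊥_ E :=
  dif_neg h

/-- In arity one, the operations are the morphisms of the enriched category. -/
def unaryIso (c : ColTuple B) (x : B) (h : c.len = 1) {y : B}
    (hy : c.col ⟨0, by omega⟩ = y) : unaryObj c x ≅ (y ⟶[E] x) :=
  eqToIso (unaryObj_eq c x h hy)

/-- In other arities, the operations form an initial object. -/
def unaryInitial (c : ColTuple B) (x : B) (h : c.len ≠ 1) : IsInitial (unaryObj c x : E) :=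
  IsInitial.ofIso initialIsInitial (eqToIso (unaryObj_eq_initial c x h).symm)

lemma unaryObj_hom {d c : ColTuple B} (f : d ⟶ c) (x : B) :
    (unaryObj c x : E) = unaryObj d x := by
  have hl : d.len = c.len := by simpa using Fintype.card_congr f.equiv
  by_cases h : c.len = 1
  · rw [unaryObj_eq c x h rfl]
    refine (unaryObj_eq d x (hl.trans h) ?_).symm
    rw [← f.col_equiv]
    congr 1
    ext
    have := (f.equiv ⟨0, by omega⟩).2
    dsimp only
    omega
  · exact (unaryObj_eq_initial c x h).trans (unaryObj_eq_initial d x (by omega)).symm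

lemma unaryObj_ext_left {c : ColTuple B} {x : B} {W Z : E} (f g : unaryObj c x ⊗ W ⟶ Z)
    (h : c.len ≠ 1) : f = g :=
  (IsInitial.ofIso (unaryInitial c x h) (mulZero (unaryInitial c x h)).symm).hom_ext f g

lemma unaryObj_ext_right {c : ColTuple B} {x : B} {W Z : E} (f g : W ⊗ unaryObj c x ⟶ Z)
    (h : c.len ≠ 1) : f = g :=
  (IsInitial.ofIso (unaryInitial c x h) (zeroMul (unaryInitial c x h)).symm).hom_ext f g

lemma insert_len_eq_one {c c' : ColTuple B} {i : Fin c.len} (hc : c.len = 1) (hc' : c'.len = 1) :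
    (c.insert i c').len = 1 := by
  change c.len - 1 + c'.len = 1
  omega

lemma insert_col_zero {c c' : ColTuple B} {i : Fin c.len} (hc : c.len = 1) (hc' : c'.len = 1) :
    (c.insert i c').col ⟨0, by rw [insert_len_eq_one hc hc']; omega⟩ =
      c'.col ⟨0, by omega⟩ := by
  have hi : i.1 = 0 := by omega
  rw [insert_col_mid _ _ _ _ _ (by omega) (by omega)]
  congr 1
  ext
  simp

/-- The partial composition of the operad associated with an enriched category. -/
def unaryComp (c : ColTuple B) (i : Fin c.len) (c' : ColTuple B) {d : B} (h : c.col i = d)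
    (x : B) : unaryObj c x ⊗ unaryObj c' d ⟶ (unaryObj (c.insert i c') x : E) :=
  if hc : c.len = 1 then
    if hc' : c'.len = 1 then
      ((unaryIso c x hc (by rw [← h]; congr 1; ext; dsimp only; omega)).hom ⊗ₘ
          (unaryIso c' d hc' rfl).hom) ≫ (β_ (d ⟶[E] x) _).hom ≫ eComp E _ d x ≫
        (unaryIso _ x (insert_len_eq_one hc hc') (insert_col_zero hc hc')).inv
    else (IsInitial.ofIso (unaryInitial c' d hc') (zeroMul (unaryInitial c' d hc')).symm).to _
  else (IsInitial.ofIso (unaryInitial c x hc) (mulZero (unaryInitial c x hc)).symm).to _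

lemma unaryComp_eq (c : ColTuple B) (i : Fin c.len) (c' : ColTuple B) {d : B} (h : c.col i = d)
    (x : B) (hc : c.len = 1) (hc' : c'.len = 1) {y : B} (hy : c'.col ⟨0, by omega⟩ = y)
    (hd : c.col ⟨0, by omega⟩ = d) :
    (unaryComp c i c' h x : _ ⟶ (_ : E)) =
      ((unaryIso c x hc hd).hom ⊗ₘ (unaryIso c' d hc' hy).hom) ≫ (β_ (d ⟶[E] x) _).hom ≫
        eComp E _ d x ≫
        (unaryIso _ x (insert_len_eq_one hc hc') ((insert_col_zero hc hc').trans hy)).inv := by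
  subst hy
  rw [unaryComp, dif_pos hc, dif_pos hc']

lemma unary_unit_right {d x : B} {X U : E} (e : X ≅ (d ⟶[E] x)) (k : U ≅ (d ⟶[E] d)) :
    (ρ_ X).inv ≫ X ◁ (eId E d ≫ k.inv) ≫ (e.hom ⊗ₘ k.hom) ≫ (β_ _ _).hom ≫ eComp E d d x =
      e.hom := by
  have : X ◁ (eId E d ≫ k.inv) ≫ (e.hom ⊗ₘ k.hom) = e.hom ⊗ₘ eId E d := by
    simp [← id_tensorHom, tensorHom_comp_tensorHom]
  rw [reassoc_of% this, BraidedCategory.braiding_naturality_assoc,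
    MonoidalCategory.tensorHom_def', Category.assoc]
  rw [← BraidedCategory.braiding_naturality_left_assoc, ← rightUnitor_inv_naturality_assoc]
  simp only [braiding_tensorUnit_right, Category.assoc,
    e_id_comp, Iso.inv_hom_id, Category.comp_id]

lemma unary_unit_left {y x : B} {X U : E} (e : X ≅ (y ⟶[E] x)) (k : U ≅ (x ⟶[E] x)) :
    (λ_ X).inv ≫ (eId E x ≫ k.inv) ▷ X ≫ (k.hom ⊗ₘ e.hom) ≫ (β_ _ _).hom ≫ eComp E y x x =
      e.hom := by
  have : (eId E x ≫ k.inv) ▷ X ≫ (k.hom ⊗ₘ e.hom) = eId E x ⊗ₘ e.hom := by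
    simp [← tensorHom_id, tensorHom_comp_tensorHom]
  rw [reassoc_of% this, BraidedCategory.braiding_naturality_assoc,
    MonoidalCategory.tensorHom_def, Category.assoc]
  rw [← BraidedCategory.braiding_naturality_right_assoc, ← leftUnitor_inv_naturality_assoc]
  simp only [braiding_tensorUnit_left, Category.assoc,
    e_comp_id, Iso.inv_hom_id, Category.comp_id]

lemma unary_assoc {x d d' y : B} {X Y Z W W' : E} (e : X ≅ (d ⟶[E] x)) (f : Y ≅ (d' ⟶[E] d))
    (g : Z ≅ (y ⟶[E] d')) (k : W ≅ (d' ⟶[E] x)) (k' : W' ≅ (y ⟶[E] d)) :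
    ((e.hom ⊗ₘ f.hom) ≫ (β_ _ _).hom ≫ eComp E d' d x ≫ k.inv) ▷ Z ≫
        (k.hom ⊗ₘ g.hom) ≫ (β_ _ _).hom ≫ eComp E y d' x =
      (α_ X Y Z).hom ≫ X ◁ ((f.hom ⊗ₘ g.hom) ≫ (β_ _ _).hom ≫ eComp E y d' d ≫ k'.inv) ≫
        (e.hom ⊗ₘ k'.hom) ≫ (β_ _ _).hom ≫ eComp E y d x := by
  have h₁ : ((e.hom ⊗ₘ f.hom) ≫ (β_ _ _).hom ≫ eComp E d' d x ≫ k.inv) ▷ Z ≫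
      (k.hom ⊗ₘ g.hom) = ((e.hom ⊗ₘ f.hom) ⊗ₘ g.hom) ≫
        ((β_ _ _).hom ≫ eComp E d' d x) ▷ _ := by
    simp only [← tensorHom_id, tensorHom_comp_tensorHom]
    simp
  have h₂ : X ◁ ((f.hom ⊗ₘ g.hom) ≫ (β_ _ _).hom ≫ eComp E y d' d ≫ k'.inv) ≫
        (e.hom ⊗ₘ k'.hom) = (e.hom ⊗ₘ (f.hom ⊗ₘ g.hom)) ≫
          _ ◁ ((β_ _ _).hom ≫ eComp E y d' d) := by
    simp [← id_tensorHom, tensorHom_comp_tensorHom]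
  rw [reassoc_of% h₁, reassoc_of% h₂, ← MonoidalCategory.associator_naturality_assoc]
  congr 1
  rw [BraidedCategory.braiding_naturality_left_assoc,
    BraidedCategory.braiding_naturality_right_assoc]
  simp only [MonoidalCategory.whiskerLeft_comp, comp_whiskerRight, Category.assoc]
  rw [← e_assoc]
  simp only [BraidedCategory.braiding_tensor_left_hom, BraidedCategory.braiding_tensor_right_hom,
    Category.assoc]
  simp only [← Category.assoc]
  congr 2
  ext <;> simp

lemma unaryIso_inv_eqToHom (c c' : ColTuple B) (x : B) (h : c.len = 1) (h' : c'.len = 1) {y : B}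
    (hy : c.col ⟨0, by omega⟩ = y) (hy' : c'.col ⟨0, by omega⟩ = y)
    (e : (unaryObj c x : E) = unaryObj c' x) :
    (unaryIso c x h hy).inv ≫ eqToHom e = ((unaryIso c' x h' hy').inv : _ ⟶ (_ : E)) := by
  simp [unaryIso]

variable (E B) in
/-- An enriched category seen as an enriched operad, with only unary operations. -/
def EnrichedOperad.ofCategory : EnrichedOperad E B where
  seq x :=
    { obj c := unaryObj c.unop x
      map f := eqToHom (unaryObj_hom f.unop x)
      map_id _ := rfl
      map_comp _ _ := by simp }
  γ c i c' _ h x := unaryComp c i c' h x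
  η x := eId E x ≫ (unaryIso (single x) x rfl rfl).inv
  γ_η c i d h x := by
    by_cases hc : c.len = 1
    · have hd : c.col ⟨0, by omega⟩ = d := by
        rw [← h]; congr 1; ext; dsimp only; omega
      change _ = eqToHom (unaryObj_hom (eqToHom (insert_single c i h)) x)
      rw [unaryComp_eq c i (single d) h x hc rfl rfl hd]
      rw [← unaryIso_inv_eqToHom c _ x hc (insert_len_eq_one hc rfl) hd
        ((insert_col_zero hc rfl).trans rfl) (unaryObj_hom (eqToHom (insert_single c i h)) x)]
      have := unary_unit_right (E := E) (unaryIso c x hc hd) (unaryIso (single d) d rfl rfl)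
      have h' := (reassoc_of% this) ((unaryIso c x hc hd).inv ≫
        eqToHom (unaryObj_hom (eqToHom (insert_single c i h)) x))
      rw [Iso.hom_inv_id_assoc] at h'
      exact h'
    · exact (unaryInitial c x hc).hom_ext _ _
  η_γ c x := by
    by_cases hc : c.len = 1
    · change _ = eqToHom (unaryObj_hom (eqToHom (single_insert x c)) x)
      rw [unaryComp_eq (single x) (0 : Fin 1) c rfl x rfl hc rfl rfl]
      rw [← unaryIso_inv_eqToHom c _ x hc (insert_len_eq_one rfl hc) rfl
        (insert_col_zero rfl hc) (unaryObj_hom (eqToHom (single_insert x c)) x)]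
      have := unary_unit_left (E := E) (unaryIso c x hc rfl) (unaryIso (single x) x rfl rfl)
      have h' := (reassoc_of% this) ((unaryIso c x hc rfl).inv ≫
        eqToHom (unaryObj_hom (eqToHom (single_insert x c)) x))
      rw [Iso.hom_inv_id_assoc] at h'
      exact h'
    · exact (unaryInitial c x hc).hom_ext _ _
  γ_γ_inner c i c' j c'' d d' h h' x := by
    by_cases hc : c.len = 1
    · by_cases hc' : c'.len = 1
      · by_cases hc'' : c''.len = 1
        · have hd : c.col ⟨0, by omega⟩ = d := by
            rw [← h]; congr 1; ext; dsimp only; omega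
          have hd' : c'.col ⟨0, by omega⟩ = d' := by
            rw [← h']; congr 1; ext; dsimp only; omega
          change _ = (α_ _ _ _).hom ≫ _ ◁ _ ≫ _ ≫
            eqToHom (unaryObj_hom (eqToHom (insert_insert_inner c i c' j c'')) x)
          rw [unaryComp_eq c i c' h x hc hc' hd' hd,
            unaryComp_eq c' j c'' h' d hc' hc'' rfl hd',
            unaryComp_eq (c.insert i c') _ c'' _ x (insert_len_eq_one hc hc') hc'' rfl
              ((insert_col_zero hc hc').trans hd'),
            unaryComp_eq c i (c'.insert j c'') h x hc (insert_len_eq_one hc' hc'')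
              (insert_col_zero hc' hc'') hd]
          simp only [Category.assoc]
          rw [unaryIso_inv_eqToHom (h' := insert_len_eq_one (insert_len_eq_one hc hc') hc'')
            (hy' := insert_col_zero (insert_len_eq_one hc hc') hc'')]
          have := unary_assoc (E := E) (unaryIso c x hc hd) (unaryIso c' d hc' hd')
            (unaryIso c'' d' hc'' rfl)
            (unaryIso (c.insert i c') x (insert_len_eq_one hc hc')
              ((insert_col_zero hc hc').trans hd'))
            (unaryIso (c'.insert j c'') d (insert_len_eq_one hc' hc'')
              (insert_col_zero hc' hc''))
          have h₁ := (reassoc_of% this) ((unaryIso (c.insert i (c'.insert j c'')) x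
            (insert_len_eq_one hc (insert_len_eq_one hc' hc''))
            ((insert_col_zero hc (insert_len_eq_one hc' hc'')).trans
              (insert_col_zero hc' hc''))).inv ≫
            eqToHom (unaryObj_hom (eqToHom (insert_insert_inner c i c' j c'')) x))
          rw [unaryIso_inv_eqToHom (h' := insert_len_eq_one (insert_len_eq_one hc hc') hc'')
            (hy' := insert_col_zero (insert_len_eq_one hc hc') hc'')] at h₁
          exact h₁
        · exact unaryObj_ext_right _ _ hc''
      · exact (IsInitial.ofIso (unaryInitial c' d hc') ((zeroMul (unaryInitial c' d hc')).symm ≪≫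
          (mulZero (IsInitial.ofIso (unaryInitial c' d hc')
            (zeroMul (unaryInitial c' d hc')).symm)).symm)).hom_ext _ _
    · rw [← cancel_epi (α_ _ _ _).inv]
      exact unaryObj_ext_left _ _ hc
  γ_γ_outer c i k hik c' c'' d d' h h' x := by
    have hc : c.len ≠ 1 := fun e => hik (by ext; omega)
    rw [← cancel_epi (α_ _ _ _).inv]
    exact unaryObj_ext_left _ _ hc
  γ_equivariant {a c a' c'} f i g d h x := by
    by_cases hc : c.len = 1
    · by_cases hc' : c'.len = 1
      · have hl : a.len = c.len := by simpa using Fintype.card_congr f.equiv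
        have hl' : a'.len = c'.len := by simpa using Fintype.card_congr g.equiv
        have hd : a.col ⟨0, by omega⟩ = d := by
          rw [← h]; congr 1; ext; dsimp only; omega
        have hd' : c.col ⟨0, by omega⟩ = d := by
          rw [← h, ← f.col_equiv]; congr 1; ext; dsimp only; omega
        have hy : a'.col ⟨0, by omega⟩ = c'.col ⟨0, by omega⟩ := by
          rw [← g.col_equiv]; congr 1; ext; dsimp only; omega
        change _ ≫ eqToHom (unaryObj_hom (insertHom f i g) x) =
          (eqToHom (unaryObj_hom f x) ⊗ₘ eqToHom (unaryObj_hom g d)) ≫ _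
        rw [unaryComp_eq c (f.equiv i) c' _ x hc hc' rfl hd',
          unaryComp_eq a i a' h x (hl.trans hc) (hl'.trans hc') hy hd]
        simp only [Category.assoc]
        rw [unaryIso_inv_eqToHom (h' := insert_len_eq_one (hl.trans hc) (hl'.trans hc'))
          (hy' := (insert_col_zero (hl.trans hc) (hl'.trans hc')).trans hy),
          tensorHom_comp_tensorHom_assoc]
        simp [unaryIso]
      · exact unaryObj_ext_right _ _ hc'
    · exact unaryObj_ext_left _ _ hc

end OfCategory

/-! ### Algebras over an enriched category -/

section Algebra

open MonoidalClosed

/-- An algebra in `E` over an enriched category `A`: an enriched functor from `A` to `E`, where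
`E` is enriched over itself by its internal hom objects. -/
structure CatAlgebra (E : Type u) [Category.{v} E] [MonoidalCategory E] [MonoidalClosed E]
    (A : Type w) [EnrichedCategory E A] where
  /-- the underlying enriched functor -/
  toFunctor : EnrichedFunctor E A E

namespace CatAlgebra

variable {E : Type u} [Category.{v} E] [MonoidalCategory E] [MonoidalClosed E]
  {A : Type w} [EnrichedCategory E A]

/-- Morphisms of algebras are enriched natural transformations: the two maps
`A(x, y) ⟶ [F x, G y]` induced by the components are required to be equal. -/
@[ext]
structure Hom (F G : CatAlgebra E A) where
  /-- the components -/
  app (x : A) : F.toFunctor.obj x ⟶ G.toFunctor.obj x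
  naturality (x y : A) :
    F.toFunctor.map x y ≫ (ihom (F.toFunctor.obj x)).map (app y) =
      G.toFunctor.map x y ≫ (pre (app x)).app (G.toFunctor.obj y)

instance : Category (CatAlgebra E A) where
  Hom F G := Hom F G
  id F := ⟨fun x => 𝟙 _, fun x y => by simp⟩
  comp {F G H} f g := ⟨fun x => f.app x ≫ g.app x, fun x y => by
    have h₁ := f.naturality x y
    have h₂ := g.naturality x y
    rw [Functor.map_comp, reassoc_of% h₁, pre_map, NatTrans.comp_app,
      ← reassoc_of% h₂, (pre (f.app x)).naturality]⟩

variable (E A) in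
/-- The forgetful functor to families of objects indexed by the objects of `A`. -/
def forget : CatAlgebra E A ⥤ (A → E) where
  obj F := F.toFunctor.obj
  map f := f.app

end CatAlgebra

end Algebra

/-! ### Graphs enriched in `E` -/

/-- A morphism from an enriched graph `X` to the graph underlying an enriched category `B`. -/
@[ext]
structure GraphHom {E : Type u} [Category.{v} E] [MonoidalCategory E] {C : Type w}
    (X : C → C → E) (B : Type w') [EnrichedCategory E B] where
  /-- the map on objects -/
  obj : C → B
  /-- the maps on morphism objects -/
  map (x y : C) : X x y ⟶ (obj x ⟶[E] obj y)

namespace GraphHom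

variable {E : Type u} [Category.{v} E] [MonoidalCategory E] {C : Type w} {X Y : C → C → E}
  {B : Type w'} [EnrichedCategory E B]

/-- Postcomposition with an enriched functor. -/
def comp {B' : Type*} [EnrichedCategory E B'] (φ : GraphHom X B) (F : EnrichedFunctor E B B') :
    GraphHom X B' where
  obj x := F.obj (φ.obj x)
  map x y := φ.map x y ≫ F.map _ _

/-- Precomposition with a morphism of graphs which is the identity on objects. -/
def precomp (α : ∀ x y, X x y ⟶ Y x y) (φ : GraphHom Y B) : GraphHom X B where
  obj := φ.obj
  map x y := α x y ≫ φ.map x y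

/-- A graph morphism to an enriched category with the same objects, identity on objects. -/
def ofId {X : B → B → E} (ι : ∀ x y, X x y ⟶ (x ⟶[E] y)) : GraphHom X B where
  obj x := x
  map := ι

/-- The graph morphism underlying an enriched functor. -/
def ofFunctor {B' : Type*} [EnrichedCategory E B'] (F : EnrichedFunctor E B B') :
    GraphHom (fun x y : B => (x ⟶[E] y)) B' where
  obj := F.obj
  map := F.map

end GraphHom

/-! ### The presentation of the enriched category `P_cart` -/

section Presentation

open CartesianMonoidalCategory MonoidalClosed

variable {E : Type u} [Category.{v} E] [CartesianMonoidalCategory E] [BraidedCategory E]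
  [HasColimits E] {C : Type v} (P : EnrichedOperad E C)

/-- The coproduct of the objects `P(c; x)` over all tuples `c` with a marked position of
colour `y`. -/
def rawGenerators (x y : C) : E :=
  ∐ fun s : (c : ColTuple C) × {i : Fin c.len // c.col i = y} => (P.seq x).obj (op s.1)

/-- The summand of the tuple `c` with marked position `i`. -/
def rawIncl (c : ColTuple C) (i : Fin c.len) {y : C} (h : c.col i = y) (x : C) :
    (P.seq x).obj (op c) ⟶ rawGenerators P x y :=
  Sigma.ι (fun s : (c : ColTuple C) × {i : Fin c.len // c.col i = y} => (P.seq x).obj (op s.1))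
    ⟨c, i, h⟩

/-- The indices of the relations coming from permutations. -/
structure PermRel (y : C) where
  /-- the permuted tuple -/
  dom : ColTuple C
  /-- the tuple -/
  cod : ColTuple C
  /-- the permutation -/
  f : dom ⟶ cod
  /-- the marked position -/
  i : Fin dom.len
  /-- its colour -/
  col_i : dom.col i = y

/-- The indices of the relations coming from partial compositions away from the marked position. -/
structure OuterRel (y : C) where
  /-- the first tuple -/
  c : ColTuple C
  /-- the marked position -/
  i : Fin c.len
  /-- its colour -/
  col_i : c.col i = y
  /-- the position of the partial composition -/
  k : Fin c.len
  /-- it differs from the marked position -/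
  ne : i ≠ k
  /-- the second tuple -/
  c' : ColTuple C

/-- The sources of the relations between generators. -/
def relObj (x y : C) : PermRel y ⊕ OuterRel y → E
  | .inl r => (P.seq x).obj (op r.cod)
  | .inr r => (P.seq x).obj (op r.c) ⊗ (P.seq (r.c.col r.k)).obj (op r.c')

/-- The first map defining the relations between generators. -/
def relLeft (x y : C) : ∀ r : PermRel y ⊕ OuterRel y, relObj P x y r ⟶ rawGenerators P x y
  | .inl r => rawIncl P r.cod (r.f.equiv r.i) ((r.f.col_equiv r.i).trans r.col_i) x
  | .inr r => fst _ _ ≫ rawIncl P r.c r.i r.col_i x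

/-- The second map defining the relations between generators. -/
def relRight (x y : C) : ∀ r : PermRel y ⊕ OuterRel y, relObj P x y r ⟶ rawGenerators P x y
  | .inl r => (P.seq x).map r.f.op ≫ rawIncl P r.dom r.i r.col_i x
  | .inr r => P.γ r.c r.k r.c' rfl x ≫
      rawIncl P (r.c.insert r.k r.c') (r.c.posOuter r.k r.c' r.i r.ne)
        ((col_posOuter _ _ _ _ _).trans r.col_i) x

/-- The graph `X` of generators of `P_cart`: `X(x, y)` is the quotient of the coproduct of the
`P(c; x)`, over all tuples `c` with a marked position of colour `y`, by the relations which
identify an operation with its permutations and with its partial compositions at the positions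
which are not marked. -/
def generators (x y : C) : E :=
  coequalizer (Sigma.desc (relLeft P x y)) (Sigma.desc (relRight P x y))

/-- The quotient map. -/
def generatorsπ (x y : C) : rawGenerators P x y ⟶ generators P x y :=
  coequalizer.π _ _

/-- The map from `P(c; x)` to the generators given by the position `i` of `c`. -/
def incl (c : ColTuple C) (i : Fin c.len) {y : C} (h : c.col i = y) (x : C) :
    (P.seq x).obj (op c) ⟶ generators P x y :=
  rawIncl P c i h x ≫ generatorsπ P x y

variable {P} in
/-- The relations of the presentation of `P_cart`, for a morphism from the graph of generators to
an enriched category. -/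
structure SatisfiesRelations {B : Type w} [EnrichedCategory E B]
    (φ : GraphHom (generators P) B) : Prop where
  comp (c : ColTuple C) (i : Fin c.len) (c' : ColTuple C) (j : Fin c'.len) {d y : C}
    (h : c.col i = d) (h' : c'.col j = y) (x : C) :
    P.γ c i c' h x ≫
        incl P (c.insert i c') (c.posInner i c' j) ((col_posInner c i c' j).trans h') x ≫
          φ.map x y =
      (incl P c i h x ⊗ₘ incl P c' j h' d) ≫ (φ.map x d ⊗ₘ φ.map d y) ≫
        eComp E (φ.obj x) (φ.obj d) (φ.obj y)
  unit (x : C) :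
    P.η x ≫ incl P (single x) (0 : Fin 1) rfl x ≫ φ.map x x = eId E (φ.obj x)

variable {P} in
/-- The enriched category structure on the set of colours `C`, with the graph morphism `ι`, is the
quotient of the free enriched category on the graph of generators by the relations: enriched
functors from it to an enriched category `B` correspond bijectively to morphisms from the graph of
generators to `B` which satisfy the relations. -/
structure IsCartPresentation [EnrichedCategory E C]
    (ι : ∀ x y : C, generators P x y ⟶ (x ⟶[E] y)) : Prop where
  relations : SatisfiesRelations (GraphHom.ofId ι)
  universal (B : Type w) [EnrichedCategory E B] (φ : GraphHom (generators P) B) :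
    SatisfiesRelations φ → ∃! F : EnrichedFunctor E C B, (GraphHom.ofId ι).comp F = φ

variable [MonoidalClosed E]

variable {P} in
/-- The action of the operations on a coalgebra: the map `P(c; x) ⟶ [V(x), V(y)]` attached to a
position `i` of `c` of colour `y` is adjoint to
`V(x) × P(c; x) ⟶ V(c₁) × ⋯ × V(cₙ) ⟶ V(cᵢ)`. -/
def OperadCoalgebra.rawAction (V : OperadCoalgebra P) : GraphHom (rawGenerators P) E where
  obj := V.obj
  map x _ := Sigma.desc fun s => curry <|
    V.coact s.1 x ≫ Pi.π (fun p => V.obj (s.1.col p)) s.2.1 ≫ eqToHom (congrArg V.obj s.2.2)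

/-- The action of `A` on a coalgebra over the opposite of the enriched category `A`: the map
`A(x, y) ⟶ [V(x), V(y)]` is adjoint to the structure map of the coalgebra in arity one. -/
def OperadCoalgebra.opAction {A : Type w} [EnrichedCategory E A]
    (V : OperadCoalgebra (EnrichedOperad.ofCategory E Aᵒᵖ)) :
    GraphHom (fun x y : A => (x ⟶[E] y)) E where
  obj x := V.obj (op x)
  map x y := curry <|
    V.obj (op x) ◁ (unaryIso (single (op y)) (op x) rfl rfl).inv ≫
      V.coact (single (op y)) (op x) ≫ Pi.π (fun _ : Fin 1 => V.obj (op y)) 0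

end Presentation

end ColouredOperad

end

open ColouredOperad MonoidalClosed

/-!
In a cartesian category a coaction `V(x) × P(c; x) ⟶ ∏ V(cᵢ)` is the same as its components
`V(x) × P(c; x) ⟶ V(cᵢ)`, so a `P`-coalgebra is an action of `P` on objects of `E` through maps
`P(c; x) ⟶ [V(x), V(cᵢ)]`: relations (a) and (b) say that these maps factor through `X(x, cᵢ)`,
relations (c) and (d) that they respect composition and units. A composite of two generators is
again a generator, by means of the partial compositions, and this determines a composition
`X(x, y) × X(y, z) ⟶ X(x, z)` because products with a fixed object preserve colimits, `E` being
closed. Hence `X` itself underlies the enriched category `P_cart`: no free enriched category is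
needed.

An action of an operad in an enriched category `A` which is universal, i.e. identifies the objects
of `A` with the colours and the morphism objects of `A` with objects of generators, induces an
isomorphism from the algebras over `A` to the coalgebras over the operad. Both isomorphisms of the
theorem are of this form, since `P` and the operad of `P_cartᵒᵖ` have universal actions in `P_cart`.
-/

noncomputable section

namespace ColouredOperad

open ColTuple CartesianMonoidalCategory

namespace ColTuple

variable {C : Type w}

lemma posInner_injective (c : ColTuple C) (i : Fin c.len) (c' : ColTuple C) :
    Function.Injective (c.posInner i c') := fun _ _ e =>
  Sum.inr_injective ((insertEquiv i).symm.injective e)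

lemma posInner_ne_posOuter (c : ColTuple C) (i : Fin c.len) (c' : ColTuple C) (j : Fin c'.len)
    (k : Fin c.len) (hk : k ≠ i) : c.posInner i c' j ≠ c.posOuter i c' k hk := fun e =>
  Sum.inr_ne_inl ((insertEquiv i).symm.injective e)

lemma exists_eq_posOuter_or_posInner (c : ColTuple C) (i : Fin c.len) (c' : ColTuple C)
    (p : Fin (c.insert i c').len) :
    (∃ k hk, p = c.posOuter i c' k hk) ∨ ∃ j, p = c.posInner i c' j := by
  obtain ⟨⟨k, hk⟩ | j, rfl⟩ := (insertEquiv i).symm.surjective p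
  exacts [.inl ⟨k, hk, rfl⟩, .inr ⟨j, rfl⟩]

lemma insertHom_posInner {d c d' c' : ColTuple C} (f : d ⟶ c) (i : Fin d.len) (g : d' ⟶ c')
    (j : Fin d'.len) :
    (insertHom f i g).equiv (d.posInner i d' j) = c.posInner (f.equiv i) c' (g.equiv j) := by
  change (insertEquiv (f.equiv i)).symm (Sum.map _ g.equiv
    (insertEquiv i ((insertEquiv i).symm (.inr j)))) = _
  rw [Equiv.apply_symm_apply]
  rfl

lemma posOuter_posInner_posInner_val (c : ColTuple C) (i : Fin c.len) (c' : ColTuple C)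
    (j k : Fin c'.len) (hjk : j ≠ k) (c'' : ColTuple C) :
    ((c.insert i c').posOuter (c.posInner i c' k) c'' (c.posInner i c' j)
      ((c.posInner_injective i c').ne hjk)).1 =
      (c.posInner i (c'.insert k c'') (c'.posOuter k c'' j hjk)).1 := by
  have : j.1 ≠ k.1 := Fin.val_injective.ne hjk
  simp only [posOuter_val, posInner_val]
  grind

lemma posOuter_posOuter_posInner_val (c : ColTuple C) (i k : Fin c.len) (hik : i ≠ k)
    (c' c'' : ColTuple C) (j : Fin c'.len) :
    ((c.insert i c').posOuter (c.posOuter i c' k hik.symm) c'' (c.posInner i c' j)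
      (c.posInner_ne_posOuter i c' j k hik.symm)).1 =
      ((c.insert k c'').posInner (c.posOuter k c'' i hik) c' j).1 := by
  have : i.1 ≠ k.1 := Fin.val_injective.ne hik
  simp only [posOuter_val, posInner_val]
  split_ifs <;> omega

lemma posInner_posInner_val (c : ColTuple C) (i : Fin c.len) (c' : ColTuple C) (j : Fin c'.len)
    (c'' : ColTuple C) (k : Fin c''.len) :
    ((c.insert i c').posInner (c.posInner i c' j) c'' k).1 =
      (c.posInner i (c'.insert j c'') (c'.posInner j c'' k)).1 := by
  simp only [posInner_val, Nat.add_assoc]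

lemma col_zero_eq {c : ColTuple C} (hc : c.len = 1) (i : Fin c.len) :
    c.col ⟨0, by omega⟩ = c.col i :=
  congrArg c.col (Fin.ext (by dsimp only; omega))

end ColTuple

section ProdInsert

variable {E : Type u} [Category.{v} E] [CartesianMonoidalCategory E] {C : Type w}

lemma associator_inv_fst (X Y Z : E) : (α_ X Y Z).inv ≫ fst (X ⊗ Y) Z = X ◁ fst Y Z :=
  CartesianMonoidalCategory.hom_ext _ _ (by simp) (by simp)

variable (V : C → E) (c : ColTuple C) (i : Fin c.len) (c' : ColTuple C) {d : C}
  (h : c.col i = d) {W : E} (t : V d ⊗ W ⟶ prodObj V c')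

lemma prodInsert_π (s : {k : Fin c.len // k ≠ i} ⊕ Fin c'.len) (p : Fin (c.insert i c').len)
    (hp : insertEquiv i p = s) :
    prodInsert V c i c' h t ≫ Pi.π (fun p => V ((c.insert i c').col p)) p =
      prodInsertAux V c i c' h t s ≫ eqToHom (by rw [← hp]; rfl) := by
  subst hp
  exact (Pi.lift_π _ _).trans (Category.comp_id _).symm

lemma prodInsert_posOuter (k : Fin c.len) (hk : k ≠ i) :
    prodInsert V c i c' h t ≫ Pi.π (fun p => V ((c.insert i c').col p)) (c.posOuter i c' k hk) =
      fst _ _ ≫ Pi.π _ k ≫ eqToHom (congrArg V (col_posOuter c i c' k hk).symm) := by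
  rw [prodInsert_π V c i c' h t (.inl ⟨k, hk⟩) (c.posOuter i c' k hk)
    ((insertEquiv i).apply_symm_apply _)]
  exact Category.assoc _ _ _

lemma prodInsert_posInner (j : Fin c'.len) :
    prodInsert V c i c' h t ≫ Pi.π (fun p => V ((c.insert i c').col p)) (c.posInner i c' j) =
      (Pi.π _ i ≫ eqToHom (congrArg V h)) ▷ W ≫ t ≫ Pi.π (fun p => V (c'.col p)) j ≫
        eqToHom (congrArg V (col_posInner c i c' j).symm) := by
  rw [prodInsert_π V c i c' h t (.inr j) (c.posInner i c' j)
    ((insertEquiv i).apply_symm_apply _)]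
  simp only [prodInsertAux, Sum.elim_inr, Category.assoc]

end ProdInsert

section SelfEnrichment

variable {E : Type u} [Category.{v} E] [MonoidalCategory E] [MonoidalClosed E]

lemma uncurry_tensorHom_eComp {X Y Z A B : E} (a : A ⟶ (ihom X).obj Y) (b : B ⟶ (ihom Y).obj Z) :
    uncurry ((a ⊗ₘ b) ≫ eComp E X Y Z) = (α_ X A B).inv ≫ uncurry a ▷ B ≫ uncurry b := by
  have uncurry_eComp : uncurry (eComp E X Y Z) = compTranspose X Y Z := uncurry_curry _
  rw [uncurry_natural_left, uncurry_eComp, compTranspose_eq, uncurry_eq a, uncurry_eq b,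
    MonoidalCategory.tensorHom_def]
  simp only [MonoidalCategory.whiskerLeft_comp, comp_whiskerRight, Category.assoc,
    associator_inv_naturality_right_assoc, associator_inv_naturality_middle_assoc,
    whisker_exchange_assoc]
  rfl

lemma uncurry_eId (X : E) : uncurry (eId E X) = (ρ_ X).hom :=
  uncurry_curry _

lemma comp_ihom_map_eq_comp_pre_iff {X X' Y Y' A : E} (a : A ⟶ (ihom X).obj Y)
    (b : A ⟶ (ihom X').obj Y') (f : X ⟶ X') (g : Y ⟶ Y') :
    a ≫ (ihom X).map g = b ≫ (pre f).app Y' ↔ uncurry a ≫ g = f ▷ A ≫ uncurry b := by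
  rw [← uncurry_injective.eq_iff, uncurry_natural_right, uncurry_natural_left, uncurry_pre,
    whisker_exchange_assoc, ← uncurry_eq]

end SelfEnrichment

section MarkedCocones

variable {E : Type u} [Category.{v} E] [CartesianMonoidalCategory E] [BraidedCategory E]
  {C : Type w}

/-- A cocone under the diagram presenting the generators `X(x, y)`: a compatible family of maps out
of the operations of output `x` with a marked position of colour `y`. Quantifying over the colour
of the marked position together with an equality, rather than over its actual colour, keeps casts
out of the relations. -/
@[ext]
structure MarkedCocone (P : EnrichedOperad E C) (x y : C) (Z : E) where
  /-- the map attached to the marked position `i` of `c` -/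
  app (c : ColTuple C) (i : Fin c.len) (h : c.col i = y) : (P.seq x).obj (op c) ⟶ Z
  permute {d c : ColTuple C} (f : d ⟶ c) (i : Fin d.len) (h : d.col i = y) :
    (P.seq x).map f.op ≫ app d i h = app c (f.equiv i) ((f.col_equiv i).trans h)
  outer (c : ColTuple C) (i : Fin c.len) (h : c.col i = y) (k : Fin c.len) (hik : i ≠ k)
    (c' : ColTuple C) {d : C} (hk : c.col k = d) :
    P.γ c k c' hk x ≫ app (c.insert k c') (c.posOuter k c' i hik)
      ((col_posOuter c k c' i hik).trans h) = fst _ _ ≫ app c i h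

namespace MarkedCocone

variable {P : EnrichedOperad E C} {x y d : C} {Z : E} (s : MarkedCocone P x y Z)

/-- The cocone obtained by composing with a map out of its point. -/
@[simps]
def postcomp {Z' : E} (f : Z ⟶ Z') : MarkedCocone P x y Z' where
  app c i h := s.app c i h ≫ f
  permute g i h := by rw [← s.permute g i h, Category.assoc]
  outer c i h k hik c' d hk := by rw [reassoc_of% s.outer c i h k hik c' hk]

lemma postcomp_id : s.postcomp (𝟙 Z) = s :=
  MarkedCocone.ext <| funext₃ fun _ _ _ => Category.comp_id _

lemma app_eqToHom {c c' : ColTuple C} (e : c = c') (i : Fin c.len) (j : Fin c'.len)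
    (hij : i.1 = j.1) (h : c.col i = y) (h' : c'.col j = y) :
    (P.seq x).map (eqToHom e).op ≫ s.app c i h = s.app c' j h' := by
  subst e
  obtain rfl : i = j := Fin.ext hij
  simp

/-- The map induced on pairs of composable operations with marked positions, where the marked
position of the composite operation is that of the second one. -/
def composite (c : ColTuple C) (i : Fin c.len) (h : c.col i = d) (c' : ColTuple C)
    (j : Fin c'.len) (h' : c'.col j = y) :
    (P.seq x).obj (op c) ⊗ (P.seq d).obj (op c') ⟶ Z :=
  P.γ c i c' h x ≫ s.app (c.insert i c') (c.posInner i c' j) ((col_posInner c i c' j).trans h')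

lemma composite_permute {a c a' c' : ColTuple C} (f : a ⟶ c) (i : Fin a.len) (h : a.col i = d)
    (g : a' ⟶ c') (j : Fin a'.len) (h' : a'.col j = y) :
    ((P.seq x).map f.op ⊗ₘ (P.seq d).map g.op) ≫ s.composite a i h a' j h' =
      s.composite c (f.equiv i) ((f.col_equiv i).trans h) c' (g.equiv j)
        ((g.col_equiv j).trans h') := by
  rw [composite, ← reassoc_of% P.γ_equivariant f i g h x, s.permute]
  simp only [insertHom_posInner]
  rfl

lemma composite_outer_right (c : ColTuple C) (i : Fin c.len) (h : c.col i = d)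
    (c' : ColTuple C) (j : Fin c'.len) (h' : c'.col j = y) (k : Fin c'.len) (hjk : j ≠ k)
    (c'' : ColTuple C) {d' : C} (hk : c'.col k = d') :
    _ ◁ P.γ c' k c'' hk d ≫ s.composite c i h (c'.insert k c'') (c'.posOuter k c'' j hjk)
      ((col_posOuter c' k c'' j hjk).trans h') = _ ◁ fst _ _ ≫ s.composite c i h c' j h' := by
  have compare_positions := s.app_eqToHom (insert_insert_inner c i c' k c'') _ _
    (posOuter_posInner_posInner_val c i c' j k hjk c'')
    ((col_posOuter ..).trans ((col_posInner ..).trans h')) ((col_posInner ..).trans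
      ((col_posOuter ..).trans h'))
  rw [← cancel_epi (α_ _ _ _).hom, composite, ← compare_positions,
    ← reassoc_of% P.γ_γ_inner c i c' k c'' h hk x,
    s.outer _ _ ((col_posInner ..).trans h') _ _ _ ((col_posInner ..).trans hk),
    whiskerRight_fst_assoc, composite, ← reassoc_of% associator_inv_fst, Iso.hom_inv_id_assoc]

lemma composite_outer_left (c : ColTuple C) (i : Fin c.len) (h : c.col i = d)
    (c' : ColTuple C) (j : Fin c'.len) (h' : c'.col j = y) (k : Fin c.len) (hik : i ≠ k)
    (c'' : ColTuple C) {d' : C} (hk : c.col k = d') :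
    P.γ c k c'' hk x ▷ _ ≫ s.composite (c.insert k c'') (c.posOuter k c'' i hik)
      ((col_posOuter c k c'' i hik).trans h) c' j h' =
        fst _ _ ▷ _ ≫ s.composite c i h c' j h' := by
  have compare_positions := s.app_eqToHom (insert_insert_outer c k i hik.symm c'' c') _ _
    (posOuter_posOuter_posInner_val c i k hik c' c'' j).symm
    ((col_posInner ..).trans h') ((col_posOuter ..).trans ((col_posInner ..).trans h'))
  rw [composite, reassoc_of% P.γ_γ_outer c k i hik.symm c'' c' hk h x, compare_positions,
    s.outer _ _ ((col_posInner ..).trans h') _ _ _ ((col_posOuter ..).trans hk),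
    whiskerRight_fst_assoc, composite]
  simp only [← Category.assoc]
  congr 2
  exact CartesianMonoidalCategory.hom_ext _ _ (by simp) (by simp)

lemma composite_inner (c : ColTuple C) (i : Fin c.len) (h : c.col i = d)
    (c' : ColTuple C) (j : Fin c'.len) {d' : C} (h' : c'.col j = d') (c'' : ColTuple C)
    (k : Fin c''.len) (h'' : c''.col k = y) :
    P.γ c i c' h x ▷ _ ≫ s.composite (c.insert i c') (c.posInner i c' j)
      ((col_posInner c i c' j).trans h') c'' k h'' =
    (α_ _ _ _).hom ≫ _ ◁ P.γ c' j c'' h' d ≫ s.composite c i h (c'.insert j c'')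
      (c'.posInner j c'' k) ((col_posInner c' j c'' k).trans h'') := by
  rw [composite, reassoc_of% P.γ_γ_inner c i c' j c'' h h' x,
    s.app_eqToHom _ _ _ (posInner_posInner_val c i c' j c'' k), composite]

lemma unit_composite (c : ColTuple C) (i : Fin c.len) (h : c.col i = y) :
    (λ_ _).inv ≫ P.η x ▷ _ ≫ s.composite (single x) (0 : Fin 1) rfl c i h = s.app c i h := by
  rw [composite, reassoc_of% P.η_γ c x, s.app_eqToHom]
  exact (posInner_val ..).trans (Nat.zero_add _)

lemma composite_unit (c : ColTuple C) (i : Fin c.len) (h : c.col i = y) :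
    (ρ_ _).inv ≫ _ ◁ P.η y ≫ s.composite c i h (single y) (0 : Fin 1) rfl = s.app c i h := by
  rw [composite, reassoc_of% P.γ_η c i h x, s.app_eqToHom]
  exact posInner_val ..

/-- A marked cocone is universal if it is a colimit cocone, i.e. if its point is a model of the
object of generators `X(x, y)`. -/
def IsUniversal : Prop :=
  ∀ ⦃Z' : E⦄ (t : MarkedCocone P x y Z'), ∃! f : Z ⟶ Z', s.postcomp f = t

namespace IsUniversal

variable {s} {x' y' x'' y'' : C} {Z' Z'' A W : E} {s' : MarkedCocone P x' y' Z'}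
  {s'' : MarkedCocone P x'' y'' Z''}

lemma hom_ext (hs : s.IsUniversal) {f g : Z ⟶ W}
    (hfg : ∀ c i h, s.app c i h ≫ f = s.app c i h ≫ g) : f = g :=
  (hs (s.postcomp g)).unique (MarkedCocone.ext (funext₃ hfg)) rfl

variable [MonoidalClosed E]

lemma whiskerLeft_hom_ext (hs : s.IsUniversal) {f g : A ⊗ Z ⟶ W}
    (hfg : ∀ c i h, A ◁ s.app c i h ≫ f = A ◁ s.app c i h ≫ g) : f = g :=
  curry_injective <| hs.hom_ext fun c i h => by
    rw [← curry_natural_left, hfg, curry_natural_left]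

lemma whiskerRight_hom_ext (hs : s.IsUniversal) {f g : Z ⊗ A ⟶ W}
    (hfg : ∀ c i h, s.app c i h ▷ A ≫ f = s.app c i h ▷ A ≫ g) : f = g := by
  rw [← cancel_epi (β_ A _).hom]
  refine hs.whiskerLeft_hom_ext fun c i h => ?_
  rw [BraidedCategory.braiding_naturality_right_assoc, hfg,
    BraidedCategory.braiding_naturality_right_assoc]

lemma tensor_hom_ext (hs : s.IsUniversal) (hs' : s'.IsUniversal) {f g : Z ⊗ Z' ⟶ W}
    (hfg : ∀ c i h c' j h', (s.app c i h ⊗ₘ s'.app c' j h') ≫ f =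
      (s.app c i h ⊗ₘ s'.app c' j h') ≫ g) : f = g :=
  hs.whiskerRight_hom_ext fun c i h => hs'.whiskerLeft_hom_ext fun c' j h' => by
    simpa only [tensorHom_def', Category.assoc] using hfg c i h c' j h'

lemma tensor_tensor_hom_ext (hs : s.IsUniversal) (hs' : s'.IsUniversal) (hs'' : s''.IsUniversal)
    {f g : Z ⊗ Z' ⊗ Z'' ⟶ W}
    (hfg : ∀ c i h c' j h' c'' k h'',
      (s.app c i h ⊗ₘ s'.app c' j h' ⊗ₘ s''.app c'' k h'') ≫ f =
        (s.app c i h ⊗ₘ s'.app c' j h' ⊗ₘ s''.app c'' k h'') ≫ g) : f = g :=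
  hs.whiskerRight_hom_ext fun c i h => curry_injective <| hs'.tensor_hom_ext hs''
    fun c' j h' c'' k h'' => by
      rw [← curry_natural_left, ← curry_natural_left]
      simpa only [tensorHom_def', Category.assoc] using
        congrArg curry (hfg c i h c' j h' c'' k h'')

end IsUniversal

end MarkedCocone

end MarkedCocones

section CartActions

variable {E : Type u} [Category.{v} E] [CartesianMonoidalCategory E] [BraidedCategory E]
  {C : Type w}

/-- An action of the operad `P` on objects `V(x)` of an enriched category `B`, by compatible maps
`P(c; x) ⟶ B(V(x), V(cᵢ))`. These are the graph morphisms `X ⟶ B` satisfying the relations of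
`P_cart`; for `B = E`, they are the `P`-coalgebras. -/
@[ext]
structure CartAction (P : EnrichedOperad E C) (B : Type w') [EnrichedCategory E B] where
  /-- the underlying objects -/
  obj : C → B
  /-- the maps `P(c; x) ⟶ B(V(x), V(y))` for the marked positions of colour `y` -/
  hom (x y : C) : MarkedCocone P x y (obj x ⟶[E] obj y)
  app_unit (x : C) : P.η x ≫ (hom x x).app (single x) (0 : Fin 1) rfl = eId E (obj x)
  app_comp (c : ColTuple C) (i : Fin c.len) {d : C} (h : c.col i = d) (c' : ColTuple C)
    (j : Fin c'.len) {y : C} (h' : c'.col j = y) (x : C) :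
    (hom x y).composite c i h c' j h' =
      ((hom x d).app c i h ⊗ₘ (hom d y).app c' j h') ≫ eComp E (obj x) (obj d) (obj y)

namespace CartAction

variable {P : EnrichedOperad E C} {A B : Type*} [EnrichedCategory E A] [EnrichedCategory E B]

/-- The action obtained from an action in `A` by applying an enriched functor. -/
def postcomp (u : CartAction P A) (F : EnrichedFunctor E A B) : CartAction P B where
  obj x := F.obj (u.obj x)
  hom x y := (u.hom x y).postcomp (F.map _ _)
  app_unit x := by simp [reassoc_of% u.app_unit x]
  app_comp c i d h c' j y h' x := by
    have := u.app_comp c i h c' j h' x =≫ F.map _ _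
    simpa [MarkedCocone.composite] using this

/-- An action in `A` is universal if it makes `A` a model of `P_cart`: the objects of `A` are the
colours of `P` and its morphism objects are objects of generators. -/
structure IsUniversal (u : CartAction P A) : Prop where
  bijective_obj : Function.Bijective u.obj
  hom (x y : C) : (u.hom x y).IsUniversal

end CartAction

lemma exists_dependent_extension {X Y : Type*} {u : X → Y} (hu : Function.Bijective u)
    {β : Y → Sort*} (f : ∀ x, β (u x)) : ∃ g : ∀ y, β y, ∀ x, g (u x) = f x :=
  ⟨Equiv.piCongrLeft β (.ofBijective u hu) f, fun x =>
    Equiv.piCongrLeft_apply_apply β (.ofBijective u hu) f x⟩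

namespace CartAction.IsUniversal

variable {P : EnrichedOperad E C} {A B : Type*} [EnrichedCategory E A] [EnrichedCategory E B]
  {u : CartAction P A}

lemma postcomp_injective (hu : u.IsUniversal) :
    Function.Injective fun F : EnrichedFunctor E A B => u.postcomp F := by
  rintro ⟨o, m, _, _⟩ ⟨o', m', _, _⟩ hFG
  obtain rfl : o = o' := funext fun a => by
    obtain ⟨x, rfl⟩ := hu.bijective_obj.surjective a
    exact congrFun (congrArg CartAction.obj hFG) x
  simp only [postcomp, CartAction.mk.injEq, heq_eq_eq, true_and] at hFG
  congr
  funext a b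
  obtain ⟨x, rfl⟩ := hu.bijective_obj.surjective a
  obtain ⟨y, rfl⟩ := hu.bijective_obj.surjective b
  exact ((hu.hom x y) _).unique (congrFun₂ hFG x y) rfl

variable [MonoidalClosed E]

/-- The extension of an action preserves composition because pairs of operations are jointly
epimorphic on pairs of morphisms of `A`, since `E` is closed. -/
lemma postcomp_surjective (hu : u.IsUniversal) :
    Function.Surjective fun F : EnrichedFunctor E A B => u.postcomp F := by
  rintro ⟨o', t, t_unit, t_comp⟩
  obtain ⟨o, ho⟩ := exists_dependent_extension hu.bijective_obj (β := fun _ => B) o'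
  obtain rfl : (fun x => o (u.obj x)) = o' := funext ho
  choose m hm using fun x y => (hu.hom x y (t x y)).exists
  obtain ⟨M, hM⟩ : ∃ M : ∀ a b : A, (a ⟶[E] b) ⟶ (o a ⟶[E] o b),
      ∀ x y, M (u.obj x) (u.obj y) = m x y := by
    choose m' hm' using fun x => exists_dependent_extension hu.bijective_obj
      (β := fun b => (u.obj x ⟶[E] b) ⟶ (o (u.obj x) ⟶[E] o b)) (m x)
    obtain ⟨M, hM⟩ := exists_dependent_extension hu.bijective_obj
      (β := fun a => ∀ b, (a ⟶[E] b) ⟶ (o a ⟶[E] o b)) m'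
    exact ⟨M, fun x y => by rw [hM, hm']⟩
  obtain rfl : (fun x y => (u.hom x y).postcomp (M _ _)) = t :=
    funext₂ fun x y => by rw [hM, hm]
  refine ⟨{ obj := o, map := M, map_id := fun a => ?_, map_comp := fun a b d => ?_ }, rfl⟩
  · obtain ⟨x, rfl⟩ := hu.bijective_obj.surjective a
    rw [← t_unit, ← u.app_unit, Category.assoc]
    rfl
  · obtain ⟨x, rfl⟩ := hu.bijective_obj.surjective a
    obtain ⟨y, rfl⟩ := hu.bijective_obj.surjective b
    obtain ⟨z, rfl⟩ := hu.bijective_obj.surjective d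
    refine (hu.hom x y).tensor_hom_ext (hu.hom y z) fun c i h c' j h' => ?_
    have := t_comp c i h c' j h' x
    simp only [MarkedCocone.composite, MarkedCocone.postcomp_app] at this
    rw [tensorHom_comp_tensorHom_assoc, ← this, ← reassoc_of% u.app_comp c i h c' j h' x]
    simp [MarkedCocone.composite]

lemma postcomp_bijective (hu : u.IsUniversal) :
    Function.Bijective fun F : EnrichedFunctor E A B => u.postcomp F :=
  ⟨hu.postcomp_injective, hu.postcomp_surjective⟩

end CartAction.IsUniversal

end CartActions

section CoalgebrasAsActions

variable {E : Type u} [Category.{v} E] [CartesianMonoidalCategory E] [BraidedCategory E]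
  {C : Type w} {P : EnrichedOperad E C}

namespace OperadCoalgebra

variable (V : OperadCoalgebra P)

/-- The component `V(x) × P(c; x) ⟶ V(y)` of the structure map of a coalgebra at a position of
colour `y`. -/
def coactAt (c : ColTuple C) (i : Fin c.len) {y : C} (h : c.col i = y) (x : C) :
    V.obj x ⊗ (P.seq x).obj (op c) ⟶ V.obj y :=
  V.coact c x ≫ Pi.π (fun p => V.obj (c.col p)) i ≫ eqToHom (congrArg V.obj h)

lemma coactAt_rfl (c : ColTuple C) (i : Fin c.len) (x : C) :
    V.coactAt c i rfl x = V.coact c x ≫ Pi.π (fun p => V.obj (c.col p)) i := by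
  simp [coactAt]

lemma coactAt_unit (x : C) :
    V.obj x ◁ P.η x ≫ V.coactAt (single x) (0 : Fin 1) rfl x = (ρ_ (V.obj x)).hom := by
  rw [← cancel_epi (ρ_ (V.obj x)).inv, Iso.inv_hom_id, ← V.coact_unit x, coactAt_rfl]

lemma coactAt_permute {d c : ColTuple C} (f : d ⟶ c) (i : Fin d.len) {y : C} (h : d.col i = y)
    (x : C) :
    V.obj x ◁ (P.seq x).map f.op ≫ V.coactAt d i h x =
      V.coactAt c (f.equiv i) ((f.col_equiv i).trans h) x := by
  rw [coactAt, reassoc_of% V.coact_permute f x, prodPermute, Pi.lift_π_assoc, Category.assoc,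
    eqToHom_trans, coactAt]

lemma coactAt_outer (c : ColTuple C) (i : Fin c.len) {y : C} (h : c.col i = y) (k : Fin c.len)
    (hik : i ≠ k) (c' : ColTuple C) {d : C} (hk : c.col k = d) (x : C) :
    V.obj x ◁ P.γ c k c' hk x ≫ V.coactAt (c.insert k c') (c.posOuter k c' i hik)
        ((col_posOuter c k c' i hik).trans h) x =
      V.obj x ◁ fst _ _ ≫ V.coactAt c i h x := by
  rw [coactAt, reassoc_of% V.coact_comp c k c' hk x, reassoc_of% prodInsert_posOuter]
  simp only [eqToHom_trans, coactAt, whiskerRight_fst_assoc, reassoc_of% associator_inv_fst]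

lemma coactAt_inner (c : ColTuple C) (i : Fin c.len) {d : C} (h : c.col i = d) (c' : ColTuple C)
    (j : Fin c'.len) {y : C} (h' : c'.col j = y) (x : C) :
    V.obj x ◁ P.γ c i c' h x ≫ V.coactAt (c.insert i c') (c.posInner i c' j)
        ((col_posInner c i c' j).trans h') x =
      (α_ _ _ _).inv ≫ V.coactAt c i h x ▷ _ ≫ V.coactAt c' j h' d := by
  rw [coactAt, reassoc_of% V.coact_comp c i c' h x, reassoc_of% prodInsert_posInner]
  simp only [eqToHom_trans, coactAt, comp_whiskerRight, Category.assoc]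

variable [MonoidalClosed E]

/-- The action adjoint to the components of the structure maps of a coalgebra. -/
def toCartAction : CartAction P E where
  obj := V.obj
  hom x y :=
    { app c i h := curry (V.coactAt c i h x)
      permute f i h := by rw [← curry_natural_left, coactAt_permute]
      outer c i h k hik c' d hk := by
        rw [← curry_natural_left, ← curry_natural_left, coactAt_outer] }
  app_unit x := uncurry_injective <| by
    rw [uncurry_natural_left, uncurry_curry, coactAt_unit, uncurry_eId]
  app_comp c i d h c' j y h' x := uncurry_injective <| by
    rw [uncurry_tensorHom_eComp, MarkedCocone.composite, uncurry_natural_left]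
    simp only [uncurry_curry]
    exact V.coactAt_inner c i h c' j h' x

end OperadCoalgebra

namespace CartAction

variable [MonoidalClosed E] (φ : CartAction P E)

lemma uncurry_app_eqToHom (c : ColTuple C) (i : Fin c.len) {y z : C} (h : c.col i = y)
    (e : y = z) (x : C) :
    uncurry ((φ.hom x y).app c i h) ≫ eqToHom (congrArg φ.obj e) =
      uncurry ((φ.hom x z).app c i (h.trans e)) := by
  subst e
  simp

lemma whiskerLeft_γ_uncurry_app (c : ColTuple C) (i : Fin c.len) {d : C} (h : c.col i = d)
    (c' : ColTuple C) (j : Fin c'.len) {y : C} (h' : c'.col j = y) (x : C) :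
    φ.obj x ◁ P.γ c i c' h x ≫ uncurry ((φ.hom x y).app (c.insert i c') (c.posInner i c' j)
        ((col_posInner c i c' j).trans h')) =
      (α_ _ _ _).inv ≫ uncurry ((φ.hom x d).app c i h) ▷ _ ≫
        uncurry ((φ.hom d y).app c' j h') := by
  rw [← uncurry_natural_left, ← uncurry_tensorHom_eComp, ← φ.app_comp, MarkedCocone.composite]

/-- The coalgebra whose structure maps have the maps adjoint to an action as components. -/
def toCoalgebra : OperadCoalgebra P where
  obj := φ.obj
  coact c x := Pi.lift fun p => uncurry ((φ.hom x _).app c p rfl)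
  coact_unit x := by
    have := congrArg uncurry (φ.app_unit x)
    rw [uncurry_natural_left, uncurry_eId] at this
    rw [Pi.lift_π, this, Iso.inv_hom_id]
  coact_permute {d c} f x := Pi.hom_ext _ _ fun p => by
    simp only [prodPermute, Category.assoc, Pi.lift_π, Pi.lift_π_assoc, ← uncurry_natural_left,
      (φ.hom x _).permute]
    exact (φ.uncurry_app_eqToHom c (f.equiv p) rfl (f.col_equiv p) x).symm
  coact_comp c i c' d h x := Pi.hom_ext _ _ fun p => by
    simp only [Category.assoc, Pi.lift_π]
    obtain ⟨k, hk, rfl⟩ | ⟨j, rfl⟩ := c.exists_eq_posOuter_or_posInner i c' p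
    · rw [prodInsert_posOuter, whiskerRight_fst_assoc, Pi.lift_π_assoc,
        reassoc_of% associator_inv_fst, φ.uncurry_app_eqToHom c k rfl (col_posOuter ..).symm x,
        ← uncurry_natural_left, ← uncurry_natural_left]
      exact congrArg uncurry ((φ.hom x _).outer c k (col_posOuter c i c' k hk).symm i hk c' h)
    · rw [prodInsert_posInner, Pi.lift_π_assoc, ← comp_whiskerRight_assoc, Pi.lift_π_assoc,
        φ.uncurry_app_eqToHom c i rfl h x,
        φ.uncurry_app_eqToHom c' j rfl (col_posInner c i c' j).symm d]
      exact φ.whiskerLeft_γ_uncurry_app c i h c' j (col_posInner c i c' j).symm x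

lemma curry_coactAt_toCoalgebra (c : ColTuple C) (i : Fin c.len) {y : C} (h : c.col i = y)
    (x : C) : curry (φ.toCoalgebra.coactAt c i h x) = (φ.hom x y).app c i h := by
  subst h
  rw [OperadCoalgebra.coactAt_rfl]
  exact (congrArg curry (Pi.lift_π _ _)).trans (curry_uncurry _)

end CartAction

namespace OperadCoalgebra

variable [MonoidalClosed E]

/-- Coalgebras over `P` are the same as actions of `P` on objects of `E`. -/
def equivCartAction : OperadCoalgebra P ≃ CartAction P E where
  toFun V := V.toCartAction
  invFun φ := φ.toCoalgebra
  left_inv V := by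
    obtain ⟨o, m, _, _, _⟩ := V
    simp only [CartAction.toCoalgebra, toCartAction, mk.injEq, heq_eq_eq, true_and]
    funext c x
    refine Pi.hom_ext _ _ fun i => (Pi.lift_π _ _).trans ((uncurry_curry _).trans ?_)
    exact coactAt_rfl ..
  right_inv φ := CartAction.ext rfl <| heq_of_eq <| funext₂ fun x y => MarkedCocone.ext <|
    funext₃ fun c i h => φ.curry_coactAt_toCoalgebra c i h x

end OperadCoalgebra

namespace CartAction

variable [MonoidalClosed E]

lemma toCoalgebra_comm_iff (φ ψ : CartAction P E)
    (f : ∀ x, φ.toCoalgebra.obj x ⟶ ψ.toCoalgebra.obj x) (c : ColTuple C) (x : C) :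
    φ.toCoalgebra.coact c x ≫ Limits.Pi.map (fun p => f (c.col p)) =
        f x ▷ (P.seq x).obj (op c) ≫ ψ.toCoalgebra.coact c x ↔
      ∀ i, (φ.hom x _).app c i rfl ≫ (ihom _).map (f _) =
        (ψ.hom x _).app c i rfl ≫ (pre (f x)).app _ := by
  have component_left (i : Fin c.len) :
      (φ.toCoalgebra.coact c x ≫ Limits.Pi.map fun p => f (c.col p)) ≫ Pi.π _ i =
        uncurry ((φ.hom x _).app c i rfl) ≫ f _ := by
    rw [Category.assoc, Limits.Pi.map_π]
    exact Pi.lift_π_assoc ..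
  have component_right (i : Fin c.len) :
      (f x ▷ (P.seq x).obj (op c) ≫ ψ.toCoalgebra.coact c x) ≫ Pi.π _ i =
        f x ▷ (P.seq x).obj (op c) ≫ uncurry ((ψ.hom x _).app c i rfl) :=
    (Category.assoc ..).trans (congrArg _ (Pi.lift_π _ _))
  refine Iff.trans ⟨fun e i => e =≫ Pi.π _ i, Pi.hom_ext _ _⟩ (forall_congr' fun i => ?_)
  rw [component_left, component_right]
  exact (comp_ihom_map_eq_comp_pre_iff ..).symm

end CartAction

end CoalgebrasAsActions

section Restriction

variable {E : Type u} [Category.{v} E] [CartesianMonoidalCategory E] [BraidedCategory E]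
  [MonoidalClosed E] {C : Type w} {P : EnrichedOperad E C} {A : Type w'} [EnrichedCategory E A]

namespace CartAction

/-- The functor sending an algebra over `A` to the `P`-coalgebra on which `P` acts through an
action `u` of `P` in `A`. -/
def restrict (u : CartAction P A) : CatAlgebra E A ⥤ OperadCoalgebra P where
  obj F := (u.postcomp F.toFunctor).toCoalgebra
  map {F G} f :=
    { app x := f.app (u.obj x)
      comm c x := by
        refine (toCoalgebra_comm_iff (u.postcomp F.toFunctor) (u.postcomp G.toFunctor)
          (fun x => f.app (u.obj x)) c x).2 fun i => ?_
        have := (u.hom x _).app c i rfl ≫= f.naturality (u.obj x) (u.obj (c.col i))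
        exact (Category.assoc ..).trans (this.trans (Category.assoc ..).symm) }

variable {u : CartAction P A}

lemma IsUniversal.faithful_restrict (hu : u.IsUniversal) : u.restrict.Faithful where
  map_injective {F G f g} hfg := CatAlgebra.Hom.ext <| funext fun a => by
    obtain ⟨x, rfl⟩ := hu.bijective_obj.surjective a
    exact congrFun (congrArg OperadCoalgebra.Hom.app hfg) x

/-- Naturality can be tested on generators. -/
lemma IsUniversal.full_restrict (hu : u.IsUniversal) : u.restrict.Full where
  map_surjective {F G} g := by
    obtain ⟨f, hf⟩ := exists_dependent_extension hu.bijective_obj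
      (β := fun a => F.toFunctor.obj a ⟶ G.toFunctor.obj a) g.app
    refine ⟨⟨f, fun a b => ?_⟩, OperadCoalgebra.Hom.ext (funext hf)⟩
    obtain ⟨x, rfl⟩ := hu.bijective_obj.surjective a
    obtain ⟨y, rfl⟩ := hu.bijective_obj.surjective b
    refine (hu.hom x y).hom_ext fun c i h => ?_
    subst h
    rw [hf, hf]
    have := (toCoalgebra_comm_iff _ _ _ c x).1 (g.comm c x) i
    exact (Category.assoc ..).symm.trans (this.trans (Category.assoc ..))

lemma IsUniversal.bijective_restrict_obj (hu : u.IsUniversal) :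
    Function.Bijective u.restrict.obj :=
  (OperadCoalgebra.equivCartAction (P := P)).symm.bijective.comp <|
    hu.postcomp_bijective.comp
      ⟨fun ⟨_⟩ ⟨_⟩ h => congrArg CatAlgebra.mk h, fun F => ⟨⟨F⟩, rfl⟩⟩

lemma IsUniversal.isIso_restrict (hu : u.IsUniversal) : u.restrict.IsIso where
  faithful := hu.faithful_restrict
  full := hu.full_restrict
  bijective_obj := hu.bijective_restrict_obj

end CartAction

end Restriction

section CartCategory

variable {E : Type u} [Category.{v} E] [CartesianMonoidalCategory E] [BraidedCategory E]
  [MonoidalClosed E] {C : Type w} {P : EnrichedOperad E C}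

namespace MarkedCocone

variable {x y d : C} {X Y Z : E} {s : MarkedCocone P x d X} {s' : MarkedCocone P d y Y}

/-- The maps `t.composite c i h` for a fixed operation, as a cocone in the second operation. -/
@[simps]
def compositeLeft (t : MarkedCocone P x y Z) (c : ColTuple C) (i : Fin c.len) (h : c.col i = d) :
    MarkedCocone P d y ((ihom ((P.seq x).obj (op c))).obj Z) where
  app c' j h' := curry (t.composite c i h c' j h')
  permute g j h' := by
    rw [← curry_natural_left]
    have := t.composite_permute (𝟙 c) i h g j h'
    rw [op_id, CategoryTheory.Functor.map_id, id_tensorHom] at this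
    exact congrArg curry this
  outer c' j h' k hjk c'' d' hk := by
    rw [← curry_natural_left, ← curry_natural_left, composite_outer_right]

lemma exists_whiskerLeft_app_comp_eq (hs' : s'.IsUniversal) (t : MarkedCocone P x y Z)
    (c : ColTuple C) (i : Fin c.len) (h : c.col i = d) :
    ∃ m : (P.seq x).obj (op c) ⊗ Y ⟶ Z, ∀ c' j h',
      _ ◁ s'.app c' j h' ≫ m = t.composite c i h c' j h' := by
  obtain ⟨m, hm⟩ := (hs' (t.compositeLeft c i h)).exists
  refine ⟨uncurry m, fun c' j h' => ?_⟩
  rw [← uncurry_natural_left, ← postcomp_app, hm, compositeLeft_app, uncurry_curry]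

/-- Since `E` is closed, pairs of composable generators are glued from pairs of operations one
variable at a time. -/
lemma IsUniversal.exists_tensorHom_app_comp_eq (hs : s.IsUniversal) (hs' : s'.IsUniversal)
    (t : MarkedCocone P x y Z) :
    ∃ m : X ⊗ Y ⟶ Z, ∀ c i h c' j h',
      (s.app c i h ⊗ₘ s'.app c' j h') ≫ m = t.composite c i h c' j h' := by
  choose m hm using exists_whiskerLeft_app_comp_eq (d := d) hs' t
  let r : MarkedCocone P x d ((ihom Y).obj Z) :=
    { app c i h := curry ((β_ _ _).hom ≫ m c i h)
      permute f i h := by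
        rw [← curry_natural_left, BraidedCategory.braiding_naturality_right_assoc]
        congr 2
        refine hs'.whiskerLeft_hom_ext fun c' j h' => ?_
        have := t.composite_permute f i h (𝟙 c') j h'
        rw [op_id, CategoryTheory.Functor.map_id, tensorHom_id] at this
        rw [whisker_exchange_assoc, hm, hm]
        exact this
      outer c i h k hik c'' d' hk := by
        rw [← curry_natural_left, ← curry_natural_left,
          BraidedCategory.braiding_naturality_right_assoc,
          BraidedCategory.braiding_naturality_right_assoc]
        congr 2
        refine hs'.whiskerLeft_hom_ext fun c' j h' => ?_
        rw [whisker_exchange_assoc, whisker_exchange_assoc, hm, hm, composite_outer_left] }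
  obtain ⟨n, hn⟩ := (hs r).exists
  refine ⟨(β_ _ _).hom ≫ uncurry n, fun c i h c' j h' => ?_⟩
  rw [tensorHom_def', Category.assoc, BraidedCategory.braiding_naturality_left_assoc,
    ← uncurry_natural_left, ← postcomp_app, hn, uncurry_curry, SymmetricCategory.symmetry_assoc,
    hm]

end MarkedCocone

variable {X : C → C → E} {s : ∀ x y, MarkedCocone P x y (X x y)}
  (hs : ∀ x y, (s x y).IsUniversal)

/-- The composition of generators, induced by the partial compositions of `P`. -/
def compGenerators (x d y : C) : X x d ⊗ X d y ⟶ X x y :=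
  ((hs x d).exists_tensorHom_app_comp_eq (hs d y) (s x y)).choose

lemma tensorHom_app_compGenerators (c : ColTuple C) (i : Fin c.len) {d : C} (h : c.col i = d)
    (c' : ColTuple C) (j : Fin c'.len) {y : C} (h' : c'.col j = y) (x : C) :
    ((s x d).app c i h ⊗ₘ (s d y).app c' j h') ≫ compGenerators hs x d y =
      (s x y).composite c i h c' j h' :=
  ((hs x d).exists_tensorHom_app_comp_eq (hs d y) (s x y)).choose_spec c i h c' j h'

lemma compGenerators_assoc (x y z t : C) :
    (α_ _ _ _).inv ≫ compGenerators hs x y z ▷ X z t ≫ compGenerators hs x z t =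
      X x y ◁ compGenerators hs y z t ≫ compGenerators hs x y t := by
  refine (hs x y).tensor_tensor_hom_ext (hs y z) (hs z t) fun c i h c' j h' c'' k h'' => ?_
  calc
    _ = (α_ _ _ _).inv ≫ ((s x z).composite c i h c' j h' ⊗ₘ (s z t).app c'' k h'') ≫
          compGenerators hs x z t := by
      rw [associator_inv_naturality_assoc, ← tensorHom_id, tensorHom_comp_tensorHom_assoc,
        Category.comp_id, tensorHom_app_compGenerators]
    _ = (α_ _ _ _).inv ≫ P.γ c i c' h x ▷ _ ≫ (s x t).composite (c.insert i c')
          (c.posInner i c' j) ((col_posInner c i c' j).trans h') c'' k h'' := by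
      rw [← tensorHom_app_compGenerators hs (c.insert i c'), ← tensorHom_id,
        tensorHom_comp_tensorHom_assoc, Category.id_comp, MarkedCocone.composite]
    _ = _ ◁ P.γ c' j c'' h' y ≫ (s x t).composite c i h (c'.insert j c'')
          (c'.posInner j c'' k) ((col_posInner c' j c'' k).trans h'') := by
      rw [MarkedCocone.composite_inner, Iso.inv_hom_id_assoc]
    _ = ((s x y).app c i h ⊗ₘ (s y t).composite c' j h' c'' k h'') ≫
          compGenerators hs x y t := by
      rw [← tensorHom_app_compGenerators hs c i h (c'.insert j c''), ← id_tensorHom,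
        tensorHom_comp_tensorHom_assoc, Category.id_comp, MarkedCocone.composite]
    _ = _ := by
      rw [← id_tensorHom, tensorHom_comp_tensorHom_assoc, Category.comp_id,
        tensorHom_app_compGenerators]

/-- The enriched category `P_cart`, with objects of generators as morphism objects: composites of
generators are generators, because of the partial compositions. -/
@[reducible]
def cartCategory : EnrichedCategory E C where
  Hom := X
  id x := P.η x ≫ (s x x).app (single x) (0 : Fin 1) rfl
  comp := compGenerators hs
  id_comp x y := (hs x y).hom_ext fun c i h => by
    rw [leftUnitor_inv_naturality_assoc, comp_whiskerRight, Category.assoc,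
      whisker_exchange_assoc, ← tensorHom_def'_assoc, tensorHom_app_compGenerators,
      MarkedCocone.unit_composite, Category.comp_id]
  comp_id x y := (hs x y).hom_ext fun c i h => by
    rw [rightUnitor_inv_naturality_assoc, MonoidalCategory.whiskerLeft_comp, Category.assoc,
      ← whisker_exchange_assoc, ← tensorHom_def_assoc, tensorHom_app_compGenerators,
      MarkedCocone.composite_unit, Category.comp_id]
  assoc := compGenerators_assoc hs

end CartCategory

section Presentation

variable {E : Type u} [Category.{v} E] [CartesianMonoidalCategory E] [BraidedCategory E]
  [HasColimits E] {C : Type v} {P : EnrichedOperad E C}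

lemma rawGenerators_hom_ext {x y : C} {Z : E} {f g : rawGenerators P x y ⟶ Z}
    (hfg : ∀ c i h, rawIncl P c i h x ≫ f = rawIncl P c i h x ≫ g) : f = g :=
  Sigma.hom_ext _ _ fun ⟨c, i, h⟩ => hfg c i h

lemma exists_rawIncl_comp_eq {x y : C} {Z : E}
    (t : ∀ (c : ColTuple C) (i : Fin c.len), c.col i = y → ((P.seq x).obj (op c) ⟶ Z)) :
    ∃ f : rawGenerators P x y ⟶ Z, ∀ c i h, rawIncl P c i h x ≫ f = t c i h :=
  ⟨Sigma.desc fun s => t s.1 s.2.1 s.2.2, fun _ _ _ => Sigma.ι_desc ..⟩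

instance (x y : C) : Epi (generatorsπ P x y) :=
  inferInstanceAs (Epi (coequalizer.π _ _))

lemma relLeft_generatorsπ {x y : C} (r : PermRel y ⊕ OuterRel y) :
    relLeft P x y r ≫ generatorsπ P x y = relRight P x y r ≫ generatorsπ P x y := by
  rw [← Sigma.ι_desc (relLeft P x y) r, ← Sigma.ι_desc (relRight P x y) r, Category.assoc,
    Category.assoc]
  exact congrArg _ (coequalizer.condition _ _)

lemma exists_generatorsπ_comp_eq {x y : C} {Z : E} (f : rawGenerators P x y ⟶ Z)
    (hf : ∀ r, relLeft P x y r ≫ f = relRight P x y r ≫ f) :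
    ∃ g : generators P x y ⟶ Z, generatorsπ P x y ≫ g = f :=
  ⟨coequalizer.desc f (Sigma.hom_ext _ _ fun r => by simpa using hf r), coequalizer.π_desc _ _⟩

lemma generators_hom_ext {x y : C} {Z : E} {f g : generators P x y ⟶ Z}
    (hfg : ∀ c i h, incl P c i h x ≫ f = incl P c i h x ≫ g) : f = g := by
  rw [← cancel_epi (generatorsπ P x y)]
  exact rawGenerators_hom_ext fun c i h => by simpa only [incl, Category.assoc] using hfg c i h

variable (P) in
/-- The colimit cocone defining the object of generators `X(x, y)`. -/
@[simps]
def generatorsCocone (x y : C) : MarkedCocone P x y (generators P x y) where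
  app c i h := incl P c i h x
  permute {d c} f i h := by
    have := relLeft_generatorsπ (P := P) (x := x) (.inl ⟨d, c, f, i, h⟩)
    exact (Category.assoc ..).symm.trans this.symm
  outer c i h k hik c' d hk := by
    subst hk
    have := relLeft_generatorsπ (P := P) (x := x) (.inr ⟨c, i, h, k, hik, c'⟩)
    exact (Category.assoc ..).symm.trans (this.symm.trans (Category.assoc ..))

variable (P) in
lemma isUniversal_generatorsCocone (x y : C) : (generatorsCocone P x y).IsUniversal := by
  intro Z t
  obtain ⟨f, hf⟩ := exists_rawIncl_comp_eq (P := P) (x := x) t.app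
  obtain ⟨g, hg⟩ := exists_generatorsπ_comp_eq f <| by
    rintro (⟨d, c, σ, i, h⟩ | ⟨c, i, h, k, hik, c'⟩)
    · exact (hf ..).trans <| (t.permute σ i h).symm.trans <|
        (congrArg _ (hf ..).symm).trans (Category.assoc ..).symm
    · exact (Category.assoc ..).trans <| (congrArg _ (hf ..)).trans <|
        (t.outer c i h k hik c' rfl).symm.trans <|
          (congrArg _ (hf ..).symm).trans (Category.assoc ..).symm
  have incl_g c i h : incl P c i h x ≫ g = t.app c i h := by rw [incl, Category.assoc, hg, hf]
  refine ⟨g, MarkedCocone.ext (funext₃ incl_g), fun g' hg' => generators_hom_ext fun c i h => ?_⟩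
  rw [incl_g, ← hg', MarkedCocone.postcomp_app, generatorsCocone_app]

namespace SatisfiesRelations

variable {A : Type w} {B : Type w'} [EnrichedCategory E A] [EnrichedCategory E B]
  {φ : GraphHom (generators P) A} {ψ : GraphHom (generators P) B}

/-- The action of `P` given by a graph morphism from the generators. -/
def toCartAction (hφ : SatisfiesRelations φ) : CartAction P A where
  obj := φ.obj
  hom x y := (generatorsCocone P x y).postcomp (φ.map x y)
  app_unit x := hφ.unit x
  app_comp c i d h c' j y h' x := by
    have := hφ.comp c i c' j h h' x
    rwa [tensorHom_comp_tensorHom_assoc] at this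

lemma postcomp_toCartAction_eq_iff (hφ : SatisfiesRelations φ) (hψ : SatisfiesRelations ψ)
    {F : EnrichedFunctor E A B} :
    hφ.toCartAction.postcomp F = hψ.toCartAction ↔ φ.comp F = ψ := by
  constructor
  · intro h
    obtain ⟨o, m⟩ := ψ
    obtain rfl : (fun x => F.obj (φ.obj x)) = o := congrArg CartAction.obj h
    have h_hom := eq_of_heq (CartAction.ext_iff.1 h).2
    refine GraphHom.ext rfl (heq_of_eq (funext₂ fun x y => generators_hom_ext fun c i hi => ?_))
    have := congrArg (fun s => MarkedCocone.app s c i hi) (congrFun₂ h_hom x y)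
    exact (Category.assoc ..).symm.trans this
  · rintro rfl
    exact CartAction.ext rfl <| heq_of_eq <| funext₂ fun x y => MarkedCocone.ext <|
      funext₃ fun c i h => Category.assoc ..

variable [MonoidalClosed E]

lemma isCartPresentation [EnrichedCategory E C] {ι : ∀ x y : C, generators P x y ⟶ (x ⟶[E] y)}
    (hι : SatisfiesRelations (GraphHom.ofId ι)) (hu : hι.toCartAction.IsUniversal) :
    IsCartPresentation.{w} ι where
  relations := hι
  universal B _ φ hφ := by
    obtain ⟨F, hF⟩ := hu.postcomp_surjective hφ.toCartAction
    refine ⟨F, (hι.postcomp_toCartAction_eq_iff hφ).1 hF, fun G hG => hu.postcomp_injective ?_⟩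
    exact ((hι.postcomp_toCartAction_eq_iff hφ).2 hG).trans hF.symm

end SatisfiesRelations

variable [MonoidalClosed E]

/-- The model of `P_cart` whose morphism objects are the objects of generators. -/
@[reducible]
def generatorsCategory (P : EnrichedOperad E C) : EnrichedCategory E C :=
  cartCategory (isUniversal_generatorsCocone P)

variable (P) in
lemma satisfiesRelations_id :
    letI := generatorsCategory P
    SatisfiesRelations (P := P) (GraphHom.ofId fun x y => 𝟙 (generators P x y)) :=
  letI := generatorsCategory P
  { comp c i c' j d y h h' x := by
      simp only [GraphHom.ofId]
      rw [Category.comp_id, id_tensorHom_id, Category.id_comp]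
      exact (tensorHom_app_compGenerators (isUniversal_generatorsCocone P) c i h c' j h' x).symm
    unit x := congrArg _ (Category.comp_id _) }

variable (P) in
lemma isUniversal_toCartAction_id :
    letI := generatorsCategory P
    (satisfiesRelations_id P).toCartAction.IsUniversal :=
  letI := generatorsCategory P
  { bijective_obj := Function.bijective_id
    hom x y := by
      change ((generatorsCocone P x y).postcomp (𝟙 _)).IsUniversal
      rw [MarkedCocone.postcomp_id]
      exact isUniversal_generatorsCocone P x y }

lemma rawIncl_rawAction (V : OperadCoalgebra P) (c : ColTuple C) (i : Fin c.len) {y : C}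
    (h : c.col i = y) (x : C) :
    rawIncl P c i h x ≫ V.rawAction.map x y = curry (V.coactAt c i h x) :=
  Sigma.ι_desc ..

lemma SatisfiesRelations.precomp_generatorsπ_restrict [EnrichedCategory E C]
    {ι : ∀ x y : C, generators P x y ⟶ (x ⟶[E] y)} (hι : SatisfiesRelations (GraphHom.ofId ι))
    (F : CatAlgebra E C) :
    ((GraphHom.ofId ι).comp F.toFunctor).precomp (generatorsπ P) =
      (hι.toCartAction.restrict.obj F).rawAction := by
  refine GraphHom.ext rfl (heq_of_eq (funext₂ fun x y => rawGenerators_hom_ext fun c i h => ?_))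
  exact (Category.assoc ..).symm.trans <| (Category.assoc ..).symm.trans <|
    ((hι.toCartAction.postcomp F.toFunctor).curry_coactAt_toCoalgebra c i h x).symm.trans
      (rawIncl_rawAction ..).symm

end Presentation

section UnaryOperads

variable {E : Type u} [Category.{v} E] [CartesianMonoidalCategory E] [BraidedCategory E]
  [MonoidalClosed E] [HasInitial E] {B : Type w} [EnrichedCategory E B]

/-- The marked cocone over the operad of an enriched category which is the identity in arity one.
Since the other objects of operations are initial, it is the only one up to isomorphism. -/
def unaryCocone (x y : B) : MarkedCocone (EnrichedOperad.ofCategory E B) x y (y ⟶[E] x) where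
  app c i h :=
    if hc : c.len = 1 then (unaryIso c x hc ((c.col_zero_eq hc i).trans h)).hom
    else (unaryInitial c x hc).to _
  permute {d c} f i h := by
    by_cases hc : c.len = 1
    · have hd : d.len = 1 := (Fin.equiv_iff_eq.1 ⟨f.equiv⟩).trans hc
      simp [hc, hd, unaryIso, EnrichedOperad.ofCategory]
    · exact (unaryInitial c x hc).hom_ext _ _
  outer c i h k hik c' d hk := unaryObj_ext_left (c := c) _ _ fun hc => hik (Fin.ext (by omega))

lemma unaryCocone_app_of_len_eq_one {c : ColTuple B} (hc : c.len = 1) (i : Fin c.len) {x y : B}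
    (h : c.col i = y) :
    (unaryCocone (E := E) x y).app c i h = (unaryIso c x hc ((c.col_zero_eq hc i).trans h)).hom :=
  dif_pos hc

lemma unaryCocone_composite (c : ColTuple B) (i : Fin c.len) {d : B} (h : c.col i = d)
    (c' : ColTuple B) (j : Fin c'.len) {y : B} (h' : c'.col j = y) (x : B) :
    (unaryCocone (E := E) x y).composite c i h c' j h' =
      ((unaryCocone x d).app c i h ⊗ₘ (unaryCocone d y).app c' j h') ≫
        (β_ (d ⟶[E] x) (y ⟶[E] d)).hom ≫ eComp E y d x := by
  by_cases hc : c.len = 1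
  · by_cases hc' : c'.len = 1
    · rw [MarkedCocone.composite, unaryCocone_app_of_len_eq_one hc,
        unaryCocone_app_of_len_eq_one hc',
        unaryCocone_app_of_len_eq_one (insert_len_eq_one hc hc')]
      refine (unaryComp_eq c i c' h x hc hc' ((c'.col_zero_eq hc' j).trans h')
        ((c.col_zero_eq hc i).trans h) =≫ _).trans ?_
      simp only [Category.assoc, Iso.inv_hom_id, Category.comp_id]
      rfl
    · exact unaryObj_ext_right _ _ hc'
  · exact unaryObj_ext_left _ _ hc

lemma isUniversal_unaryCocone (x y : B) : (unaryCocone (E := E) x y).IsUniversal := by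
  intro Z t
  refine ⟨(unaryIso (single y) x rfl rfl).inv ≫ t.app (single y) (0 : Fin 1) rfl,
    MarkedCocone.ext (funext₃ fun c i h => ?_), ?_⟩
  · by_cases hc : c.len = 1
    · obtain rfl : c = single y := ColTuple.ext_col hc fun p hp =>
        (c.col_zero_eq hc ⟨p, hp⟩).symm.trans ((c.col_zero_eq hc i).trans h)
      obtain rfl : i = (0 : Fin 1) := Subsingleton.elim (α := Fin 1) _ _
      rw [MarkedCocone.postcomp_app, unaryCocone_app_of_len_eq_one rfl]
      exact Iso.hom_inv_id_assoc ..
    · exact (unaryInitial c x hc).hom_ext _ _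
  · rintro f rfl
    rw [MarkedCocone.postcomp_app, unaryCocone_app_of_len_eq_one rfl]
    exact (Iso.inv_hom_id_assoc ..).symm

namespace CartAction

variable (E) (A : Type w) [EnrichedCategory E A]

/-- The action of the operad of the opposite of `A` in `A`. -/
def ofOp : CartAction (EnrichedOperad.ofCategory E Aᵒᵖ) A where
  obj := unop
  hom := unaryCocone
  app_unit x := by
    rw [unaryCocone_app_of_len_eq_one rfl]
    exact (Category.assoc ..).trans ((congrArg _ (Iso.inv_hom_id _)).trans (Category.comp_id _))
  app_comp c i d h c' j y h' x :=
    (unaryCocone_composite c i h c' j h' x).trans <|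
      congrArg _ (SymmetricCategory.symmetry_assoc ..)

lemma isUniversal_ofOp : (ofOp E A).IsUniversal where
  bijective_obj := equivToOpposite.symm.bijective
  hom := isUniversal_unaryCocone

end CartAction

end UnaryOperads

section OppositeActions

variable {E : Type u} [Category.{v} E] [CartesianMonoidalCategory E] [BraidedCategory E]
  [MonoidalClosed E] [HasColimits E] {A : Type w} [EnrichedCategory E A]

lemma OperadCoalgebra.opAction_map (V : OperadCoalgebra (EnrichedOperad.ofCategory E Aᵒᵖ))
    (x y : A) :
    V.opAction.map x y = (unaryIso (single (op y)) (op x) rfl rfl).inv ≫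
      curry (V.coactAt (single (op y)) (0 : Fin 1) rfl (op x)) :=
  let e := unaryIso (E := E) (single (op y)) (op x) rfl rfl
  (congrArg (fun f => curry (V.obj (op x) ◁ e.inv ≫ f))
    (V.coactAt_rfl (single (op y)) (0 : Fin 1) (op x)).symm).trans (curry_natural_left ..)

lemma ofFunctor_eq_opAction_restrict (F : CatAlgebra E A) :
    GraphHom.ofFunctor F.toFunctor = ((CartAction.ofOp E A).restrict.obj F).opAction := by
  refine GraphHom.ext rfl (heq_of_eq (funext₂ fun x y => ?_))
  let φ := (CartAction.ofOp E A).postcomp F.toFunctor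
  let e := unaryIso (E := E) (single (op y)) (op x) rfl rfl
  have adjoint : curry (φ.toCoalgebra.coactAt (single (op y)) (0 : Fin 1) rfl (op x)) =
      e.hom ≫ F.toFunctor.map x y := by
    rw [φ.curry_coactAt_toCoalgebra, ← unaryCocone_app_of_len_eq_one rfl (0 : Fin 1) rfl]
    rfl
  exact (Iso.inv_hom_id_assoc e _).symm.trans <|
    (congrArg (e.inv ≫ ·) adjoint.symm).trans (φ.toCoalgebra.opAction_map x y).symm

end OppositeActions

end ColouredOperad

end

theorem mainTheorem11 {E : Type u} [Category.{v} E] [CartesianMonoidalCategory E]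
    [BraidedCategory E] [MonoidalClosed E] [HasColimits E] {C : Type v}
    (P : EnrichedOperad E C) :
    ∃ (_ : EnrichedCategory E C) (ι : ∀ x y : C, generators P x y ⟶ (x ⟶[E] y)),
      IsCartPresentation.{w} ι ∧
      ∃ (Φ : IsoCat (OperadCoalgebra P) (OperadCoalgebra (EnrichedOperad.ofCategory E Cᵒᵖ)))
        (Ψ : IsoCat (OperadCoalgebra (EnrichedOperad.ofCategory E Cᵒᵖ)) (CatAlgebra E C)),
        Φ.functor ⋙ OperadCoalgebra.forget (EnrichedOperad.ofCategory E Cᵒᵖ) ⋙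
            Pi.comap (fun _ => E) Opposite.op = OperadCoalgebra.forget P ∧
        Ψ.functor ⋙ CatAlgebra.forget E C =
          OperadCoalgebra.forget (EnrichedOperad.ofCategory E Cᵒᵖ) ⋙
            Pi.comap (fun _ => E) Opposite.op ∧
        (∀ V : OperadCoalgebra (EnrichedOperad.ofCategory E Cᵒᵖ),
          GraphHom.ofFunctor (Ψ.functor.obj V).toFunctor = V.opAction) ∧
        (∀ V : OperadCoalgebra P,
          ((GraphHom.ofId ι).comp (Ψ.functor.obj (Φ.functor.obj V)).toFunctor).precomp
            (generatorsπ P) = V.rawAction) := by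
  let inst := generatorsCategory P
  have hι := satisfiesRelations_id P
  have hu := isUniversal_toCartAction_id P
  have := hu.isIso_restrict
  have := (CartAction.isUniversal_ofOp E C).isIso_restrict
  let Θ := hι.toCartAction.restrict.asIsomorphism.symm
  let Ψ := (CartAction.ofOp E C).restrict.asIsomorphism.symm
  have hΘ (V) : Ψ.functor.obj ((Θ.trans Ψ.symm).functor.obj V) = Θ.functor.obj V :=
    Functor.congr_obj Ψ.counit_eq (Θ.functor.obj V)
  refine ⟨inst, _, hι.isCartPresentation hu, Θ.trans Ψ.symm, Ψ, ?_, ?_, fun V => ?_, fun V => ?_⟩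
  · exact congrArg (· ⋙ OperadCoalgebra.forget P) Θ.unit_eq.symm
  · exact congrArg (· ⋙ OperadCoalgebra.forget _ ⋙ Pi.comap (fun _ => E) op) Ψ.unit_eq.symm
  · rw [ofFunctor_eq_opAction_restrict]
    exact congrArg OperadCoalgebra.opAction (Functor.congr_obj Ψ.unit_eq.symm V)
  · rw [hΘ, hι.precomp_generatorsπ_restrict]
    exact congrArg OperadCoalgebra.rawAction (Functor.congr_obj Θ.unit_eq.symm V)
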